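/- Let $B$ be a unital C$^*$-algebra and let $\alpha,\beta:B\to B$ be $\mathbb C$-linear maps. A $B$-valued C$^*$-noncommutative probability space is a pair $(A,E)$, where $A$ is a unital C$^*$-algebra containing $B$ as a unital C$^*$-subalgebra and $E:A\to B$ is a linear $B$-bimodule map with $E(b)=b$ for all $b\in B$ and $\|E(a)\|\le\|a\|$ for all $a\in A$ (that is, a projection of norm $1$ onto $B$, if $B\ne0$). Its $B$-valued free cumulants $\kappa_n:A^n\to B$ ($n\ge1$) are determined by the moment-cumulant formula $E(a_1\cdots a_n)=\sum_{\pi}\kappa_\pi(a_1,\dots,a_n)$, where $\pi$ runs over the noncrossing partitions of $\{1,\dots,n\}$ and $\kappa_\pi$ is given by nested evaluation; equivalently, by $$E(a_1\cdots a_n)=\sum_{V}\kappa_{k}\bigl(a_{i_1}E(a_{i_1+1}\cdots a_{i_2-1}),\,\dots,\,a_{i_k}E(a_{i_k+1}\cdots a_n)\bigr),$$ where $V=\{i_1<\dots<i_k\}$ runs over the subsets of $\{1,\dots,n\}$ with $i_1=1$ and empty products are $1$. A $B$-circular operator with covariance $(\alpha,\beta)$ in $(A,E)$ is an element $z\in A$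 such that the pair $(z,z^*)$ is $B$-Gaussian, i.e. $\kappa_n(x_1b_1,\dots,x_nb_n)=0$ for all $n\geq 1$ with $n\ne2$, all $x_1,\dots,x_n\in\{z,z^*\}$ and all $b_1,\dots,b_n\in B$, with covariance determined by $$E(z^*bz)=\alpha(b),\quad E(zbz^*)=\beta(b),\quad E(zbz)=E(z^*bz^*)=0,\quad E(z)=E(z^*)=0\qquad(b\in B).$$ Then there exist a $B$-valued C$^*$-noncommutative probability space $(A,E)$ and a $B$-circular operator $z\in A$ with covariance $(\alpha,\beta)$ if and only if $\alpha$ and $\beta$ are both completely positive. -/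

import Mathlib

universe u v

open scoped CStarAlgebra

/-- A `B`-valued `*`-noncommutative probability space `(A, E)`. The inclusion of the unital
`*`-subalgebra `B` into `A` is recorded as an injective unital `*`-homomorphism `incl`. -/
structure StarProbSpace (B : Type*) [Ring B] [StarRing B] [Algebra ℂ B] [StarModule ℂ B]
    (A : Type*) [Ring A] [StarRing A] [Algebra ℂ A] [StarModule ℂ A] where
  /-- the inclusion of `B` into `A` -/
  incl : B →⋆ₐ[ℂ] A
  incl_injective : Function.Injective incl
  /-- the conditional expectation -/
  expect : A →ₗ[ℂ] B
  expect_incl : ∀ b : B, expect (incl b) = b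
  expect_bimodule : ∀ (b₁ : B) (a : A) (b₂ : B),
    expect (incl b₁ * a * incl b₂) = b₁ * expect a * b₂

namespace StarProbSpace

section

variable {B : Type*} [Ring B] [StarRing B] [Algebra ℂ B] [StarModule ℂ B]
variable {A : Type*} [Ring A] [StarRing A] [Algebra ℂ A] [StarModule ℂ A]

/-- A composition `c` of `n` cuts `a₁, …, aₙ` into consecutive nonempty segments; this is the
`i`-th one, as a list. -/
def segment {n : ℕ} (a : Fin n → A) (c : Composition n) (i : Fin c.length) : List A :=
  List.ofFn fun j : Fin (c.blocksFun i) => a (c.embedding i j)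

/-- If the `i`-th segment is `x, y₁, …, yₘ`, this is `x E(y₁ ⋯ yₘ)` (which is `x` if `m = 0`). -/
def collapse (P : StarProbSpace B A) {n : ℕ} (a : Fin n → A) (c : Composition n)
    (i : Fin c.length) : A :=
  a (c.embedding i ⟨0, c.blocks_pos' i i.isLt⟩) * P.incl (P.expect (segment a c i).tail.prod)

/-- The `B`-valued free cumulants `κₙ(a₁, …, aₙ)` of `(A, E)`, that is, the solution of the
moment-cumulant formula
`E(a₁ ⋯ aₙ) = ∑ κ_π(a₁, …, aₙ)`, the sum being over the noncrossing partitions `π` of `{1, …, n}`,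
with `κ_π` given by nested evaluation.
Grouping the noncrossing partitions by the block `V = {1 = i₁ < ⋯ < i_k}` that contains `1`,
and carrying out the sum over all noncrossing partitions of the intervals between consecutive
elements of `V` (and after `i_k`), this formula reads
`E(a₁ ⋯ aₙ) = ∑_V κ_k(a_{i₁} E(a_{i₁+1} ⋯ a_{i₂-1}), …, a_{i_k} E(a_{i_k+1} ⋯ aₙ))`.
The sets `V` containing `1` correspond to the compositions `c` of `n`, the elements of `V` being
the first positions of the segments of `c`, and the term with `V = {1, …, n}` is `κₙ(a₁, …, aₙ)`.
(For `n = 0` the value is `1`, by convention.) -/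
def freeCumulant (P : StarProbSpace B A) (n : ℕ) (a : Fin n → A) : B :=
  P.expect (List.ofFn a).prod -
    ∑ c : {c : Composition n // c.length < n}, P.freeCumulant c.1.length (P.collapse a c.1)
termination_by n
decreasing_by exact c.2

/-- `z` is a `B`-circular element with covariance `(α, β)`: the distribution of the pair
`(z, z*)` is `B`-Gaussian, i.e. its free cumulants `κₙ(x₁ b₁, …, xₙ bₙ)` with `xᵢ ∈ {z, z*}` and
`bᵢ ∈ B` vanish unless `n = 2`, and its covariance is the one determined by `(α, β)`. -/
structure IsCircular (P : StarProbSpace B A) (α β : B →ₗ[ℂ] B) (z : A) : Prop where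
  cumulant_eq_zero : ∀ n : ℕ, 1 ≤ n → n ≠ 2 → ∀ x : Fin n → A, (∀ i, x i = z ∨ x i = star z) →
    ∀ b : Fin n → B, P.freeCumulant n (fun i => x i * P.incl (b i)) = 0
  expect_star_mul : ∀ b : B, P.expect (star z * P.incl b * z) = α b
  expect_mul_star : ∀ b : B, P.expect (z * P.incl b * star z) = β b
  expect_mul : ∀ b : B, P.expect (z * P.incl b * z) = 0
  expect_star_mul_star : ∀ b : B, P.expect (star z * P.incl b * star z) = 0
  expect_self : P.expect z = 0
  expect_star : P.expect (star z) = 0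

end

end StarProbSpace

/-- A `B`-valued C*-noncommutative probability space: `A` is a unital C*-algebra, and `E` is a
contractive projection onto `B` (so of norm `1` unless `B = 0`). The inclusion, an injective
`*`-homomorphism between C*-algebras, is automatically isometric. -/
structure CStarProbSpace (B : Type*) [CStarAlgebra B] (A : Type*) [CStarAlgebra A] extends
    StarProbSpace B A where
  norm_expect_le : ∀ a : A, ‖expect a‖ ≤ ‖a‖

/-! Necessity. The maps `α` and `β` are the compressions `b ↦ E(z* b z)` and `b ↦ E(z b z*)`, so it
is enough that a contractive projection `E` is completely positive. Perturbing a self-adjoint `h` to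
`h + it` and comparing norms for all real `t` shows that `E(h)` is self-adjoint; then `‖1 - E(a)‖ ≤
1` for `0 ≤ a ≤ 1` gives positivity (`expect_nonneg`). At the matrix level, `M` is positive as soon
as all `∑ bᵢ* Mᵢⱼ bⱼ` are (`CStarMatrix.nonneg_of_isPosKernel`), and the bimodule property moves the
`bᵢ` inside `E`, which leaves `E` of a sum of squares.

Sufficiency. On the full Fock space over `B` with two generators, where `⟨xᵢ, b xⱼ⟩ = δᵢⱼ γᵢ(b)` and
`γ` is the pair `(α, β)`, the creation operators satisfy `ℓᵢ* b ℓⱼ = δᵢⱼ γᵢ(b)`; take `z = ℓ₁ + ℓ₂*`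
and the vacuum expectation. Complete positivity is what makes the inner product positive
(`FockWord.isPosKernel_kernel`). The space itself is neither separated nor completed: the C*-algebra
is the completion of the algebra of bounded adjointable operators in the operator seminorm.

Gaussianity. The relations of the `ℓᵢ` give the Schwinger–Dyson recursion `moment_cons`: the first
field is contracted with some later one, and the moments of the two remaining stretches factor out.
This is the moment-cumulant formula restricted to blocks `V` of size 2. Collapsing a tuple of fields
yields fields again, so induction on `n` kills every cumulant of order `n ≥ 1`, `n ≠ 2`
(`freeCumulant_field`). -/

/-! ### Sums over splittings of a list, and segments of a composition. -/

/-- The sum of `f u c v` over all ways to write a list as `u ++ c :: v`. -/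
def List.sumSplits {X M : Type*} [AddCommMonoid M] (f : List X → X → List X → M) : List X → M
  | [] => 0
  | c :: l => f [] c l + l.sumSplits fun u => f (c :: u)

namespace List

variable {X M : Type*} [AddCommMonoid M]

theorem sumSplits_congr {f g : List X → X → List X → M} {l : List X}
    (h : ∀ u c v, l = u ++ c :: v → f u c v = g u c v) : l.sumSplits f = l.sumSplits g := by
  induction l generalizing f g with
  | nil => rfl
  | cons c l ih =>
    rw [sumSplits, sumSplits, h [] c l rfl, ih fun u d v e => h (c :: u) d v (by simp [e])]

theorem sumSplits_add (f g : List X → X → List X → M) (l : List X) :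
    (l.sumSplits fun u c v => f u c v + g u c v) = l.sumSplits f + l.sumSplits g := by
  induction l generalizing f g with
  | nil => simp [sumSplits]
  | cons c l ih => simp only [sumSplits, ih, add_add_add_comm]

theorem map_sumSplits {N : Type*} [AddCommMonoid N] (φ : M →+ N) (f : List X → X → List X → M)
    (l : List X) : φ (l.sumSplits f) = l.sumSplits fun u c v => φ (f u c v) := by
  induction l generalizing f with
  | nil => simp [sumSplits]
  | cons c l ih => simp only [sumSplits, map_add, ih]

/-- Both sides run over the decompositions `l = u ++ c :: u' ++ c' :: v'`, grouped by the first or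
by the second marked letter. -/
theorem sumSplits_sumSplits (g : List X → X → List X → X → List X → M) (l : List X) :
    (l.sumSplits fun u c v => v.sumSplits fun u' c' v' => g u c u' c' v') =
      l.sumSplits fun w c' v' => w.sumSplits fun u c u' => g u c u' c' v' := by
  induction l generalizing g with
  | nil => rfl
  | cons c l ih =>
    simp only [sumSplits, zero_add, sumSplits_add]
    rw [ih fun u => g (c :: u)]

theorem sumSplits_eq_sum (f : List X → X → List X → M) (l : List X) :
    l.sumSplits f = ∑ k : Fin l.length, f (l.take k) l[k] (l.drop (k + 1)) := by
  induction l generalizing f with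
  | nil => rfl
  | cons c l ih =>
    rw [sumSplits, ih]
    exact (Fin.sum_univ_succ (n := l.length) fun k : Fin (l.length + 1) =>
      f ((c :: l).take k) (c :: l)[k] ((c :: l).drop (k + 1))).symm

end List

theorem Composition.ofFn_embedding {X : Type*} {n : ℕ} (x : Fin n → X) (c : Composition n)
    (i : Fin c.length) : (List.ofFn fun j : Fin (c.blocksFun i) => x (c.embedding i j)) =
      ((List.ofFn x).take (c.sizeUpTo (i + 1))).drop (c.sizeUpTo i) := by
  have h := c.sizeUpTo_succ' i
  have h' := c.sizeUpTo_le (i + 1)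
  refine List.ext_getElem ?_ fun j h₁ h₂ => ?_
  · simp
    omega
  · simp
    congr 1

/-! ### Moments and free cumulants of sums of free creation and annihilation operators. -/

namespace StarProbSpace

variable {B : Type*} [Ring B] [StarRing B] [Algebra ℂ B] [StarModule ℂ B]
  {A : Type*} [Ring A] [StarRing A] [Algebra ℂ A] [StarModule ℂ A]

section Expect

variable (P : StarProbSpace B A)

theorem expect_one : P.expect 1 = 1 := by
  simpa using P.expect_incl 1

theorem expect_mul_incl (a : A) (b : B) : P.expect (a * P.incl b) = P.expect a * b := by
  simpa using P.expect_bimodule 1 a b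

theorem expect_incl_mul (b : B) (a : A) : P.expect (P.incl b * a) = b * P.expect a := by
  simpa using P.expect_bimodule b a 1

end Expect

/-- Free creation operators in a `B`-valued probability space: `ℓᵢ* b ℓⱼ = δᵢⱼ γᵢ(b)`, and the
expectation is a vacuum expectation. -/
structure IsFreeCreation (P : StarProbSpace B A) {ι : Type*} [DecidableEq ι] (γ : ι → B → B)
    (ℓ : ι → A) : Prop where
  star_mul_mul : ∀ i j b, star (ℓ i) * P.incl b * ℓ j = if i = j then P.incl (γ i b) else 0
  expect_mul : ∀ i a, P.expect (ℓ i * a) = 0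
  expect_mul_star : ∀ i a, P.expect (a * star (ℓ i)) = 0

namespace IsFreeCreation

variable {P : StarProbSpace B A} {ι : Type*} [DecidableEq ι] {γ : ι → B → B} {ℓ : ι → A}

variable (P ℓ) in
/-- The creation part of the field operator `(ℓᵢ + ℓ_{σ i}*) b`. -/
def creation (x : ι × B) : A := ℓ x.1 * P.incl x.2

variable (P ℓ) in
/-- The annihilation part of the field operator `(ℓᵢ + ℓ_{σ i}*) b`. -/
def annihilation (σ : ι → ι) (x : ι × B) : A := star (ℓ (σ x.1)) * P.incl x.2

variable (P ℓ) in
/-- The field operator `(ℓᵢ + ℓ_{σ i}*) b`. -/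
def field (σ : ι → ι) (x : ι × B) : A := (ℓ x.1 + star (ℓ (σ x.1))) * P.incl x.2

variable (P ℓ) in
/-- The moment of a list of field operators. -/
def moment (σ : ι → ι) (l : List (ι × B)) : B := P.expect (l.map (field P ℓ σ)).prod

variable (P ℓ) in
/-- The covariance of two field operators. -/
def cov (σ : ι → ι) (x : ι × B) (b : B) (y : ι × B) : B :=
  P.expect (field P ℓ σ x * P.incl b * field P ℓ σ y)

omit [DecidableEq ι] in
theorem field_eq (σ : ι → ι) (x : ι × B) :
    field P ℓ σ x = creation P ℓ x + annihilation P ℓ σ x := add_mul _ _ _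

variable (h : P.IsFreeCreation γ ℓ) (σ : ι → ι)
include h

theorem expect_creation_mul (x : ι × B) (a : A) : P.expect (creation P ℓ x * a) = 0 := by
  rw [creation, mul_assoc, h.expect_mul]

theorem expect_mul_annihilation (x : ι × B) (a : A) :
    P.expect (a * annihilation P ℓ σ x) = 0 := by
  rw [annihilation, ← mul_assoc, P.expect_mul_incl, h.expect_mul_star, zero_mul]

theorem expect_field (x : ι × B) : P.expect (field P ℓ σ x) = 0 := by
  have h1 := h.expect_creation_mul x 1
  have h2 := h.expect_mul_annihilation σ x 1
  rw [mul_one] at h1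
  rw [one_mul] at h2
  rw [field_eq, map_add, h1, h2, add_zero]

theorem annihilation_mul_creation (x : ι × B) (b : B) (y : ι × B) :
    annihilation P ℓ σ x * P.incl b * creation P ℓ y =
      if σ x.1 = y.1 then P.incl (γ (σ x.1) (x.2 * b) * y.2) else 0 := by
  have : annihilation P ℓ σ x * P.incl b * creation P ℓ y =
      star (ℓ (σ x.1)) * P.incl (x.2 * b) * ℓ y.1 * P.incl y.2 := by
    simp only [annihilation, creation, map_mul, mul_assoc]
  rw [this, h.star_mul_mul]
  split_ifs <;> simp

/-- A creation operator on the far left or an annihilation operator on the far right has zero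
expectation, so only annihilation followed by creation survives. -/
theorem cov_eq (x : ι × B) (b : B) (y : ι × B) :
    cov P ℓ σ x b y = if σ x.1 = y.1 then γ (σ x.1) (x.2 * b) * y.2 else 0 := by
  have h1 : cov P ℓ σ x b y = P.expect (annihilation P ℓ σ x * P.incl b * creation P ℓ y) := by
    rw [cov, field_eq, field_eq, mul_add, map_add, h.expect_mul_annihilation, add_zero, add_mul,
      add_mul, map_add, mul_assoc (creation P ℓ x), h.expect_creation_mul, zero_add]
  rw [h1, h.annihilation_mul_creation]
  split_ifs
  · rw [P.expect_incl]
  · rw [map_zero]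

theorem incl_cov (x : ι × B) (b : B) (y : ι × B) :
    annihilation P ℓ σ x * P.incl b * creation P ℓ y = P.incl (cov P ℓ σ x b y) := by
  rw [h.annihilation_mul_creation, h.cov_eq]
  split_ifs <;> simp

/-- Expansion of a product of field operators applied to the vacuum, according to the first
generator that is not annihilated. -/
theorem expect_mul_prod (a : A) (l : List (ι × B)) :
    P.expect (a * (l.map (field P ℓ σ)).prod) = P.expect a * moment P ℓ σ l +
      l.sumSplits fun u c v => P.expect
        (a * P.incl (moment P ℓ σ u) * creation P ℓ c * (v.map (field P ℓ σ)).prod) := by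
  induction hn : l.length using Nat.strong_induction_on generalizing a l with
  | _ n ih =>
  -- The Schwinger–Dyson recursion for shorter lists is the induction hypothesis with `a` an
  -- annihilation operator, because `E(a) = 0` then.
  have hmoment : ∀ (x : ι × B) (l : List (ι × B)), l.length < n → moment P ℓ σ (x :: l) =
      l.sumSplits fun u c v => cov P ℓ σ x (moment P ℓ σ u) c * moment P ℓ σ v := by
    intro x l hl
    have h1 := ih _ hl (annihilation P ℓ σ x) l rfl
    have h2 := h.expect_mul_annihilation σ x 1
    rw [one_mul] at h2
    rw [h2, zero_mul, zero_add] at h1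
    rw [moment, List.map_cons, List.prod_cons, field_eq, add_mul, map_add, h.expect_creation_mul,
      zero_add, h1]
    simp only [h.incl_cov, P.expect_incl_mul]
    rfl
  cases l with
  | nil => simp [List.sumSplits, moment, P.expect_one]
  | cons x l =>
    have hl : l.length < n := by rw [← hn]; simp
    have h1 := ih _ hl (a * annihilation P ℓ σ x) l rfl
    rw [h.expect_mul_annihilation, zero_mul, zero_add] at h1
    -- Contracting `x` with `c` leaves an element of `B`, which is absorbed into `a`; the induction
    -- hypothesis then applies again, to the rest `v`.
    have h2 : ∀ u c v, l = u ++ c :: v →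
        P.expect (a * annihilation P ℓ σ x * P.incl (moment P ℓ σ u) * creation P ℓ c *
          (v.map (field P ℓ σ)).prod) =
        P.expect a * (cov P ℓ σ x (moment P ℓ σ u) c * moment P ℓ σ v) +
          v.sumSplits fun u' c' v' => P.expect (a * P.incl
            (cov P ℓ σ x (moment P ℓ σ u) c * moment P ℓ σ u') * creation P ℓ c' *
              (v'.map (field P ℓ σ)).prod) := by
      intro u c v e
      have hv : v.length < n := by rw [e] at hl; simp at hl; omega
      have h3 := ih _ hv (a * P.incl (cov P ℓ σ x (moment P ℓ σ u) c)) v rfl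
      rw [P.expect_mul_incl] at h3
      have h4 : a * annihilation P ℓ σ x * P.incl (moment P ℓ σ u) * creation P ℓ c =
          a * P.incl (cov P ℓ σ x (moment P ℓ σ u) c) := by
        rw [← h.incl_cov]
        simp only [mul_assoc]
      rw [h4, h3, mul_assoc]
      simp only [map_mul, mul_assoc]
    rw [List.sumSplits_congr h2, List.sumSplits_add, List.sumSplits_sumSplits] at h1
    have h5 := List.map_sumSplits (AddMonoidHom.mulLeft (P.expect a))
      (fun u c v => cov P ℓ σ x (moment P ℓ σ u) c * moment P ℓ σ v) l
    simp only [AddMonoidHom.coe_mulLeft] at h5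
    rw [← h5, ← hmoment x l hl] at h1
    -- Regrouped by the first uncontracted letter `c'`, the inner sum over the partner `c` of `x` is
    -- the recursion for the moment of `x :: w`.
    have h6 : ∀ w c' v', l = w ++ c' :: v' →
        (w.sumSplits fun u c u' => P.expect (a * P.incl
            (cov P ℓ σ x (moment P ℓ σ u) c * moment P ℓ σ u') * creation P ℓ c' *
              (v'.map (field P ℓ σ)).prod)) =
        P.expect (a * P.incl (moment P ℓ σ (x :: w)) * creation P ℓ c' *
          (v'.map (field P ℓ σ)).prod) := by
      intro w c' v' e
      have hw : w.length < n := by rw [e] at hl; simp at hl; omega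
      have h7 := List.map_sumSplits
        ({ toFun := fun b => P.expect (a * P.incl b * creation P ℓ c' *
              (v'.map (field P ℓ σ)).prod)
           map_zero' := by simp
           map_add' := by simp [mul_add, add_mul] } : B →+ B)
        (fun u c v => cov P ℓ σ x (moment P ℓ σ u) c * moment P ℓ σ v) w
      rw [← hmoment x w hw] at h7
      exact h7.symm
    rw [List.sumSplits_congr h6] at h1
    rw [List.sumSplits, List.map_cons, List.prod_cons, ← mul_assoc, field_eq, mul_add, add_mul,
      map_add, h1]
    have h8 : moment P ℓ σ ([] : List (ι × B)) = 1 := by simp [moment, P.expect_one]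
    rw [h8, map_one, mul_one]
    abel

/-- The Schwinger–Dyson equation for field operators. -/
theorem moment_cons (x : ι × B) (l : List (ι × B)) : moment P ℓ σ (x :: l) =
    l.sumSplits fun u c v => cov P ℓ σ x (moment P ℓ σ u) c * moment P ℓ σ v := by
  have h1 := h.expect_mul_prod σ (annihilation P ℓ σ x) l
  have h2 := h.expect_mul_annihilation σ x 1
  rw [one_mul] at h2
  rw [h2, zero_mul, zero_add] at h1
  rw [moment, List.map_cons, List.prod_cons, field_eq, add_mul, map_add, h.expect_creation_mul,
    zero_add, h1]
  simp only [h.incl_cov, P.expect_incl_mul]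
  rfl

omit [DecidableEq ι] h in
-- The inserted expectations only change the coefficients in `B`; this closes the induction in
-- `freeCumulant_field`.
theorem collapse_field {n : ℕ} (x : Fin n → ι × B) (c : Composition n) :
    P.collapse (fun j => field P ℓ σ (x j)) c = fun i => field P ℓ σ
      ((x (c.embedding i ⟨0, c.blocks_pos' i i.isLt⟩)).1,
        (x (c.embedding i ⟨0, c.blocks_pos' i i.isLt⟩)).2 *
          P.expect (segment (fun j => field P ℓ σ (x j)) c i).tail.prod) := by
  funext i
  simp only [collapse, field, map_mul, mul_assoc]

omit [DecidableEq ι] h in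
-- The block `V = {1, k + 2}` contributes exactly the `k`-th term of the Schwinger–Dyson sum.
theorem expect_collapse_pair {n : ℕ} (x : Fin (n + 1) → ι × B) (k : Fin n)
    (c : Composition (n + 1)) (hc : c.blocks = [(k : ℕ) + 1, n - (k : ℕ)]) :
    P.expect (List.ofFn (P.collapse (fun j => field P ℓ σ (x j)) c)).prod =
      cov P ℓ σ (x 0) (moment P ℓ σ ((List.ofFn (Fin.tail x)).take k)) (x k.succ) *
        moment P ℓ σ ((List.ofFn (Fin.tail x)).drop (k + 1)) := by
  have hlen : c.length = 2 := by rw [← c.blocks_length, hc]; rfl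
  have hL : List.ofFn (fun j => field P ℓ σ (x j)) =
      field P ℓ σ (x 0) :: (List.ofFn (Fin.tail x)).map (field P ℓ σ) := by
    rw [List.ofFn_succ, List.map_ofFn]
    rfl
  have s0 : c.sizeUpTo 0 = 0 := c.sizeUpTo_zero
  have s1 : c.sizeUpTo 1 = k + 1 := by simp [Composition.sizeUpTo, hc]
  have s2 : c.sizeUpTo 2 = n + 1 := by simp [Composition.sizeUpTo, hc]; omega
  have i0 : (0 : ℕ) < c.length := by omega
  have i1 : (1 : ℕ) < c.length := by omega
  have e0 : c.embedding ⟨0, i0⟩ ⟨0, c.blocks_pos' 0 i0⟩ = 0 := by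
    ext; simp [Composition.coe_embedding]
  have e1 : c.embedding ⟨1, i1⟩ ⟨0, c.blocks_pos' 1 i1⟩ = k.succ := by
    ext; simp [Composition.coe_embedding, s1]
  have g0 : (segment (fun j => field P ℓ σ (x j)) c ⟨0, i0⟩).tail =
      ((List.ofFn (Fin.tail x)).take k).map (field P ℓ σ) := by
    rw [segment, Composition.ofFn_embedding (fun j => field P ℓ σ (x j)), hL]
    simp [s0, s1]
  have g1 : (segment (fun j => field P ℓ σ (x j)) c ⟨1, i1⟩).tail =
      ((List.ofFn (Fin.tail x)).drop (k + 1)).map (field P ℓ σ) := by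
    rw [segment, Composition.ofFn_embedding (fun j => field P ℓ σ (x j)), hL]
    simp only [s1, s2, Nat.reduceAdd]
    rw [List.take_of_length_le (by simp), List.drop_succ_cons, List.tail_drop, List.map_drop]
  have hprod : ∀ (m : ℕ) (hm : m = 2) (f : Fin m → A), (List.ofFn f).prod =
      f ⟨0, by omega⟩ * f ⟨1, by omega⟩ := by
    rintro m rfl f
    simp [List.ofFn_succ]
  rw [hprod _ hlen]
  simp only [collapse, e0, e1, g0, g1]
  rw [← mul_assoc, P.expect_mul_incl]
  rfl

/-- By induction only compositions of length 2 contribute to the subtracted sum. For `n ≥ 3` that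
sum is the Schwinger–Dyson expansion of the whole moment; for `n ≤ 2` it is zero. -/
theorem freeCumulant_field (n : ℕ) (x : Fin n → ι × B) :
    P.freeCumulant n (fun j => field P ℓ σ (x j)) =
      if n = 2 then moment P ℓ σ (List.ofFn x) else if n = 0 then 1 else 0 := by
  induction n using Nat.strong_induction_on with
  | _ n ih =>
  rw [freeCumulant]
  have hmom : P.expect (List.ofFn fun j => field P ℓ σ (x j)).prod = moment P ℓ σ (List.ofFn x) := by
    rw [moment, List.map_ofFn]
    rfl
  have hterm : ∀ c : {c : Composition n // c.length < n},
      P.freeCumulant c.1.length (P.collapse (fun j => field P ℓ σ (x j)) c.1) =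
        if c.1.length = 2 then
          P.expect (List.ofFn (P.collapse (fun j => field P ℓ σ (x j)) c.1)).prod else 0 := by
    intro c
    have hpos : c.1.length ≠ 0 := (c.1.length_pos_of_pos (by have := c.2; omega)).ne'
    rw [collapse_field, ih _ c.2, if_neg hpos, moment, List.map_ofFn]
    rfl
  rw [hmom, Fintype.sum_congr _ _ hterm]
  rcases n with _ | _ | _ | n
  · rw [Finset.sum_eq_zero fun c _ => by have := c.2; omega]
    simp [moment, P.expect_one]
  · rw [Finset.sum_eq_zero fun c _ => if_neg (by have := c.2; omega)]
    simp [moment, h.expect_field]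
  · rw [Finset.sum_eq_zero fun c _ => if_neg (by have := c.2; omega)]
    simp
  · rw [if_neg (by omega), if_neg (by omega), sub_eq_zero, List.ofFn_succ, h.moment_cons,
      List.sumSplits_eq_sum]
    -- The compositions of `n + 3` with two blocks, indexed by the number `k` of letters between the
    -- two elements of `V`.
    let e : Fin (n + 2) → {c : Composition (n + 3) // c.length < n + 3} := fun k =>
      ⟨⟨[(k : ℕ) + 1, n + 2 - (k : ℕ)], by
        intro i hi
        simp at hi
        omega, by simp; omega⟩, by simp [Composition.length]⟩
    have he : ∀ k, (e k).1.blocks = [(k : ℕ) + 1, n + 2 - (k : ℕ)] := fun k => rfl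
    have hinj : Function.Injective e := fun k k' hk => by
      have h1 := congrArg (fun c => c.1.blocks) hk
      simp only [he, List.cons.injEq] at h1
      exact Fin.ext (by omega)
    have hrange : ∀ c ∉ Set.range e, (if c.1.length = 2 then
        P.expect (List.ofFn (P.collapse (fun j => field P ℓ σ (x j)) c.1)).prod else 0) = 0 := by
      intro c hc
      refine if_neg fun h2 => hc ?_
      obtain ⟨p, q, hpq⟩ := List.length_eq_two.mp (c.1.blocks_length.trans h2)
      have hsum := c.1.blocks_sum
      have hp : 0 < p := c.1.blocks_pos (by simp [hpq])
      have hq : 0 < q := c.1.blocks_pos (by simp [hpq])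
      simp only [hpq, List.sum_cons, List.sum_nil, add_zero] at hsum
      refine ⟨⟨p - 1, by omega⟩, Subtype.ext (Composition.ext ?_)⟩
      rw [he, hpq]
      simp only [List.cons.injEq, and_true]
      omega
    rw [← Fintype.sum_of_injective e hinj
      (fun k => cov P ℓ σ (x 0) (moment P ℓ σ ((List.ofFn (Fin.tail x)).take k)) (x k.succ) *
        moment P ℓ σ ((List.ofFn (Fin.tail x)).drop (k + 1))) _ hrange fun k => by
        rw [if_pos (show (e k).1.length = 2 from rfl), expect_collapse_pair σ x k _ (he k)]]
    have hlen : (List.ofFn fun i : Fin (n + 2) => x i.succ).length = n + 2 := List.length_ofFn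
    refine Fintype.sum_equiv (finCongr hlen) _ _ fun k => ?_
    have hk : (List.ofFn fun i : Fin (n + 2) => x i.succ)[k] = x (Fin.cast hlen k).succ := by
      simp only [Fin.getElem_fin, List.getElem_ofFn]
      rfl
    rw [hk]
    rfl

/-- The sum of a free creation operator and a different free annihilation operator is circular. -/
theorem isCircular {i j : ι} (hij : i ≠ j) {α β : B →ₗ[ℂ] B} (hα : ∀ b, γ i b = α b)
    (hβ : ∀ b, γ j b = β b) : P.IsCircular α β (ℓ i + star (ℓ j)) := by
  -- With `σ` the swap of `i` and `j`, the fields of index `i` and `j` are `z b` and `z* b`.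
  have hi : ∀ b, field P ℓ (Equiv.swap i j) (i, b) = (ℓ i + star (ℓ j)) * P.incl b := by
    simp [field]
  have hj : ∀ b, field P ℓ (Equiv.swap i j) (j, b) = star (ℓ i + star (ℓ j)) * P.incl b := by
    simp [field, add_comm]
  have hi1 : field P ℓ (Equiv.swap i j) (i, 1) = ℓ i + star (ℓ j) := by simp [hi]
  have hj1 : field P ℓ (Equiv.swap i j) (j, 1) = star (ℓ i + star (ℓ j)) := by simp [hj]
  have hcov := h.cov_eq (Equiv.swap i j)
  simp only [cov] at hcov
  refine ⟨fun n h1 h2 x hx b => ?_, fun b => ?_, fun b => ?_, fun b => ?_, fun b => ?_, ?_, ?_⟩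
  · have hy : ∀ k, ∃ y : ι × B, x k * P.incl (b k) = field P ℓ (Equiv.swap i j) y := by
      intro k
      rcases hx k with hk | hk
      · exact ⟨(i, b k), by rw [hk, hi]⟩
      · exact ⟨(j, b k), by rw [hk, hj]⟩
    choose y hy using hy
    rw [funext hy, h.freeCumulant_field, if_neg h2, if_neg (by omega)]
  · rw [← hj1, ← hi1, hcov]
    simp [hα]
  · rw [← hj1, ← hi1, hcov]
    simp [hβ]
  · rw [← hi1, hcov]
    simp [hij.symm]
  · rw [← hj1, hcov]
    simp [hij]
  · rw [← hi1, h.expect_field]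
  · rw [← hj1, h.expect_field]

end IsFreeCreation

end StarProbSpace

/-! ### Positive matrices over a C*-algebra via quadratic expressions. -/

/-- A matrix over a C*-algebra is a positive kernel if all the associated quadratic expressions
`∑ bᵢ* Mᵢⱼ bⱼ` are positive. -/
def IsPosKernel {n B : Type*} [Fintype n] [NonUnitalSemiring B] [StarRing B] [PartialOrder B]
    (M : n → n → B) : Prop :=
  ∀ b : n → B, 0 ≤ ∑ i, ∑ j, star (b i) * M i j * b j

section GenericCStarAlgebra

variable {C : Type*} [NonUnitalCStarAlgebra C] [PartialOrder C] [StarOrderedRing C]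

theorem exists_eq_star_mul_self_of_nonneg {a : C} (ha : 0 ≤ a) : ∃ r : C, a = star r * r :=
  CStarAlgebra.nonneg_iff_eq_star_mul_self.mp ha

theorem IsSelfAdjoint.exists_orthogonal_sub {a : C} (ha : IsSelfAdjoint a) :
    ∃ p r : C, 0 ≤ p ∧ a = p - star r * r ∧ p * (star r * r) = 0 := by
  obtain ⟨r, hr⟩ := exists_eq_star_mul_self_of_nonneg (CFC.negPart_nonneg a)
  exact ⟨a⁺, r, CFC.posPart_nonneg a, by rw [← hr, CFC.posPart_sub_negPart a ha],
    by rw [← hr, CFC.posPart_mul_negPart a]⟩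

theorem CStarAlgebra.norm_one_le_one (A : Type*) [CStarAlgebra A] : ‖(1 : A)‖ ≤ 1 := by
  cases subsingleton_or_nontrivial A
  · rw [Subsingleton.elim (1 : A) 0, norm_zero]
    exact zero_le_one
  · exact CStarRing.norm_one.le

end GenericCStarAlgebra

section PosKernel

variable {n B : Type*} [Fintype n] [CStarAlgebra B] [PartialOrder B] [StarOrderedRing B]

theorem CStarMatrix.isPosKernel_of_nonneg {M : CStarMatrix n n B} (hM : 0 ≤ M) :
    IsPosKernel fun i j => M i j := by
  intro b
  obtain ⟨R, rfl⟩ := exists_eq_star_mul_self_of_nonneg hM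
  have : ∑ i, ∑ j, star (b i) * (star R * R) i j * b j =
      ∑ l, star (∑ i, R l i * b i) * ∑ j, R l j * b j := by
    simp only [CStarMatrix.mul_apply, CStarMatrix.star_apply, star_sum, star_mul, Finset.sum_mul,
      Finset.mul_sum, mul_assoc]
    rw [Finset.sum_comm' (t' := Finset.univ) (s' := fun _ => Finset.univ) (by simp)]
    conv_rhs => rw [Finset.sum_comm]
    refine Finset.sum_congr rfl fun j _ => ?_
    rw [Finset.sum_comm]
  rw [this]
  exact Finset.sum_nonneg fun l _ => star_mul_self_nonneg _

omit [PartialOrder B] [StarOrderedRing B] in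
theorem CStarMatrix.sum_conjugate_apply (M N : CStarMatrix n n B) (j : n) :
    (star N * M * N) j j = ∑ i, ∑ k, star (N i j) * M i k * N k j := by
  simp only [CStarMatrix.mul_apply, CStarMatrix.star_apply, Finset.sum_mul]
  rw [Finset.sum_comm]

theorem CStarMatrix.eq_zero_of_diag_star_mul_self_nonpos {R : CStarMatrix n n B}
    (h : ∀ j, (star R * R) j j ≤ 0) : R = 0 := by
  ext i j
  have h1 : ∑ i, star (R i j) * R i j ≤ 0 := by
    simpa [CStarMatrix.mul_apply, CStarMatrix.star_apply] using h j
  have h2 := (Finset.sum_eq_zero_iff_of_nonneg (s := Finset.univ)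
    (f := fun i => star (R i j) * R i j) fun i _ => star_mul_self_nonneg _).mp
    (le_antisymm h1 (Finset.sum_nonneg fun i _ => star_mul_self_nonneg _)) i (Finset.mem_univ _)
  simpa using h2

/-- Write `M = p - N` with `N = R* R` and `p N = 0`. Then `N* M N = -(R N)* (R N)`, whereas the
hypothesis on the columns of `N` makes its diagonal nonnegative. Hence `R N = 0`, so `N* N = 0` and
`N = 0`. -/
theorem CStarMatrix.nonneg_of_isPosKernel_of_isSelfAdjoint {M : CStarMatrix n n B}
    (hsa : IsSelfAdjoint M) (hM : IsPosKernel fun i j => M i j) : 0 ≤ M := by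
  obtain ⟨p, R, hp, hdec, hort⟩ := hsa.exists_orthogonal_sub
  set N := star R * R with hR
  have hNs : star N = N := by rw [hR, star_mul, star_star]
  have h1 : star N * M * N = -(star (R * N) * (R * N)) := by
    rw [hdec, mul_assoc, sub_mul, hort, zero_sub, mul_neg, star_mul R N, mul_assoc (star N),
      ← mul_assoc (star R), ← hR]
  have h2 : R * N = 0 := by
    refine CStarMatrix.eq_zero_of_diag_star_mul_self_nonpos fun j => ?_
    have h3 := hM fun i => N i j
    rw [← CStarMatrix.sum_conjugate_apply, h1] at h3
    exact neg_nonneg.mp h3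
  have h4 : star N * N = 0 := by
    rw [hNs]
    nth_rewrite 1 [hR]
    rw [mul_assoc, h2, mul_zero]
  have h5 : N = 0 := CStarRing.star_mul_self_eq_zero_iff N |>.mp h4
  rwa [hdec, h5, sub_zero]

/-- It remains to see that `M` is self-adjoint. The quadratic expressions of `M` and `M*` agree, so
those of the self-adjoint matrix `D = i(M - M*)` vanish; the self-adjoint case applies to `D` and
`-D`, giving `D = 0`. -/
theorem CStarMatrix.nonneg_of_isPosKernel {M : CStarMatrix n n B}
    (hM : IsPosKernel fun i j => M i j) : 0 ≤ M := by
  have hstar : IsPosKernel fun i j => star M i j := by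
    intro b
    have := star_nonneg_iff.mpr (hM b)
    simp only [star_sum, star_mul, star_star] at this
    rw [Finset.sum_comm] at this
    simpa [CStarMatrix.star_apply, mul_assoc] using this
  have hQ : ∀ b : n → B, ∑ i, ∑ j, star (b i) * M i j * b j =
      ∑ i, ∑ j, star (b i) * star M i j * b j := by
    intro b
    have := (IsSelfAdjoint.of_nonneg (hM b)).star_eq
    rw [← this]
    simp only [star_sum, star_mul, star_star]
    rw [Finset.sum_comm]
    simp [CStarMatrix.star_apply, mul_assoc]
  set D : CStarMatrix n n B := Complex.I • (M - star M) with hD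
  have hDsa : IsSelfAdjoint D := by
    rw [isSelfAdjoint_iff, hD, star_smul, star_sub, star_star, ← neg_sub, smul_neg]
    simp
  have hDQ : ∀ b : n → B, ∑ i, ∑ j, star (b i) * D i j * b j = 0 := by
    intro b
    have : ∀ i j, star (b i) * D i j * b j = Complex.I • (star (b i) * M i j * b j -
        star (b i) * star M i j * b j) := by
      intro i j
      rw [hD, CStarMatrix.smul_apply, CStarMatrix.sub_apply]
      simp [mul_sub, sub_mul]
    simp only [this, ← Finset.smul_sum, Finset.sum_sub_distrib, hQ b, sub_self, smul_zero]
  have h1 : 0 ≤ D := nonneg_of_isPosKernel_of_isSelfAdjoint hDsa fun b => (hDQ b).ge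
  have h2 : 0 ≤ -D := nonneg_of_isPosKernel_of_isSelfAdjoint hDsa.neg fun b => by
    have : ∀ i j, star (b i) * (-D) i j * b j = -(star (b i) * D i j * b j) := by
      intro i j
      rw [CStarMatrix.neg_apply, mul_neg, neg_mul]
    simp only [this, Finset.sum_neg_distrib, hDQ b, neg_zero, le_refl]
  have h3 : D = 0 := le_antisymm (neg_nonneg.mp h2) h1
  have h4 : M - star M = 0 := by
    simpa [hD] using h3
  exact nonneg_of_isPosKernel_of_isSelfAdjoint (sub_eq_zero.mp h4).symm hM

/-- Complete positivity of the covariance enters the Fock space construction here. -/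
theorem IsPosKernel.map {M : n → n → B} (hM : IsPosKernel M) (φ : B →CP B) :
    IsPosKernel fun i j => φ (M i j) :=
  CStarMatrix.isPosKernel_of_nonneg
    (φ.map_cstarMatrix_nonneg _
      (CStarMatrix.nonneg_of_isPosKernel (M := CStarMatrix.ofMatrix M) hM))

omit [StarOrderedRing B] in
theorem IsPosKernel.conj {M : n → n → B} (hM : IsPosKernel M) (d : n → B) :
    IsPosKernel fun i j => star (d i) * M i j * d j := by
  intro b
  simpa [mul_assoc] using hM fun i => d i * b i

theorem IsPosKernel.add {M N : n → n → B} (hM : IsPosKernel M) (hN : IsPosKernel N) :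
    IsPosKernel fun i j => M i j + N i j := by
  intro b
  simpa [mul_add, add_mul, Finset.sum_add_distrib] using add_nonneg (hM b) (hN b)

omit [StarOrderedRing B] in
theorem IsPosKernel.zero : IsPosKernel fun _ _ : n => (0 : B) := by
  intro b
  simp

theorem IsPosKernel.sum {ι : Type*} {s : Finset ι} {M : ι → n → n → B}
    (hM : ∀ x ∈ s, IsPosKernel (M x)) : IsPosKernel fun i j => ∑ x ∈ s, M x i j := by
  classical
  induction s using Finset.induction_on with
  | empty => simpa using IsPosKernel.zero
  | insert a s ha ih =>
    simp only [Finset.sum_insert ha]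
    exact (hM a (by simp)).add (ih fun x hx => hM x (by simp [hx]))

theorem IsPosKernel.const {m : B} (hm : 0 ≤ m) : IsPosKernel fun _ _ : n => m := by
  intro b
  have : ∑ i, ∑ j, star (b i) * m * b j = star (∑ i, b i) * m * ∑ j, b j := by
    simp [star_sum, Finset.sum_mul, Finset.mul_sum]
    rw [Finset.sum_comm]
  rw [this]
  exact star_left_conjugate_nonneg hm _

end PosKernel

/-! ### Contractive projections are completely positive. -/

namespace CStarProbSpace

variable {B : Type u} [CStarAlgebra B] [PartialOrder B] [StarOrderedRing B]
  {A : Type v} [CStarAlgebra A] (P : CStarProbSpace B A)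

/-- Divide by `t` and let `t → ∞`, for `y` and for `-y`; the positive cone is closed. -/
theorem eq_zero_of_forall_smul_le {y c : B} (h : ∀ t : ℝ, t • y ≤ c) : y = 0 := by
  have key : ∀ y : B, (∀ t : ℝ, t • y ≤ c) → y ≤ 0 := by
    intro y h
    have h1 : ∀ k : ℕ, y ≤ ((k : ℝ) + 1)⁻¹ • c := fun k => by
      have h2 := smul_le_smul_of_nonneg_left (h ((k : ℝ) + 1))
        (show (0 : ℝ) ≤ ((k : ℝ) + 1)⁻¹ by positivity)
      rwa [smul_smul, inv_mul_cancel₀ (by positivity), one_smul] at h2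
    have h3 : Filter.Tendsto (fun k : ℕ => ((k : ℝ) + 1)⁻¹ • c) Filter.atTop
        (nhds ((0 : ℝ) • c)) := by
      refine Filter.Tendsto.smul_const ?_ c
      simpa [one_div] using tendsto_one_div_add_atTop_nhds_zero_nat (𝕜 := ℝ)
    rw [zero_smul] at h3
    exact ge_of_tendsto' h3 h1
  refine le_antisymm (key y h) (neg_nonpos.mp (key (-y) fun t => ?_))
  simpa using h (-t)

/-- Let `E(h) = x + iy`. Since `‖h + it‖² ≤ ‖h‖² + t²`, contractivity forces `(y + t)² ≤ ‖h‖² + t²`,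
so `2ty ≤ ‖h‖²` for every real `t`, and `y = 0`. -/
theorem isSelfAdjoint_expect {h : A} (hh : IsSelfAdjoint h) : IsSelfAdjoint (P.expect h) := by
  let _ := CStarAlgebra.spectralOrder A
  have _ := CStarAlgebra.spectralOrderedRing A
  have hdec := realPart_add_I_smul_imaginaryPart (P.expect h)
  set x : B := (realPart (P.expect h) : B) with hx
  set y : B := (imaginaryPart (P.expect h) : B) with hy
  have hxs : star x = x := (realPart (P.expect h)).2
  have hys : star y = y := (imaginaryPart (P.expect h)).2
  have hbound : ∀ t : ℝ, t • ((2 : ℝ) • y) ≤ algebraMap ℝ B (‖h‖ ^ 2) := by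
    intro t
    set a : A := h + (Complex.I * t) • (1 : A) with ha
    have hEa : P.expect a = x + Complex.I • (y + t • (1 : B)) := by
      rw [ha, map_add, map_smul, P.expect_one, ← hdec, add_assoc, smul_add, mul_smul]
      simp
    have hnorm : ‖a‖ ^ 2 ≤ ‖h‖ ^ 2 + t ^ 2 := by
      have hs : star (Complex.I * (t : ℂ)) = -(Complex.I * t) := by simp
      have e1 : star a * a = h * h + (t ^ 2 : ℝ) • (1 : A) := by
        have e3 : -((Complex.I * (t : ℂ)) * (Complex.I * t)) = ((t ^ 2 : ℝ) : ℂ) := by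
          push_cast
          linear_combination (-(t : ℂ) ^ 2) * Complex.I_mul_I
        rw [ha, star_add, hh.star_eq, star_smul, star_one, hs, ← Complex.coe_smul, ← e3]
        simp only [add_mul, mul_add, smul_mul_assoc, mul_smul_comm, one_mul, mul_one]
        module
      rw [sq, ← CStarRing.norm_star_mul_self, e1]
      refine (norm_add_le _ _).trans ?_
      rw [norm_smul, sq ‖h‖]
      refine add_le_add (norm_mul_le _ _) ?_
      rw [Real.norm_of_nonneg (sq_nonneg t)]
      exact mul_le_of_le_one_right (sq_nonneg t) (CStarAlgebra.norm_one_le_one A)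
    have hE : ‖P.expect a‖ ^ 2 ≤ ‖h‖ ^ 2 + t ^ 2 :=
      (pow_le_pow_left₀ (norm_nonneg _) (P.norm_expect_le a) 2).trans hnorm
    set w : B := y + t • (1 : B) with hw
    have hws : star w = w := by rw [hw, star_add, hys, star_smul, star_one, star_trivial]
    -- Adding the two orders of multiplication cancels the commutator of `x` and `w`.
    have hxw : star (P.expect a) * P.expect a + P.expect a * star (P.expect a) =
        (2 : ℝ) • (star x * x + star w * w) := by
      have hv : star (Complex.I • w) = -(Complex.I • w) := by simp [star_smul, hws]
      have hvv : (Complex.I • w) * (Complex.I • w) = -(w * w) := by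
        rw [smul_mul_smul_comm, Complex.I_mul_I, neg_one_smul]
      rw [hEa, star_add, hv, hxs, hws, ← neg_neg (w * w), ← hvv]
      generalize Complex.I • w = v
      rw [two_smul]
      noncomm_ring
    have hle : ∀ b : B, ‖b‖ ^ 2 ≤ ‖h‖ ^ 2 + t ^ 2 →
        star b * b ≤ algebraMap ℝ B (‖h‖ ^ 2 + t ^ 2) := fun b hb =>
      CStarAlgebra.star_mul_le_algebraMap_norm_sq.trans (algebraMap_mono B hb)
    have h1 := hle _ hE
    have h2 := hle (star (P.expect a)) (by rwa [norm_star])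
    rw [star_star] at h2
    have h3 : w * w ≤ algebraMap ℝ B (‖h‖ ^ 2 + t ^ 2) := by
      have h4 := add_le_add h1 h2
      rw [hxw, ← two_smul ℝ, hws] at h4
      have h5 := smul_le_smul_of_nonneg_left h4 (show (0 : ℝ) ≤ 2⁻¹ by norm_num)
      rw [smul_smul, smul_smul, inv_mul_cancel₀ two_ne_zero, one_smul, one_smul] at h5
      exact (le_add_of_nonneg_left (star_mul_self_nonneg x)).trans h5
    have h4 : w * w = y * y + t • ((2 : ℝ) • y) + algebraMap ℝ B (t ^ 2) := by
      rw [hw, Algebra.algebraMap_eq_smul_one]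
      simp only [add_mul, mul_add, smul_mul_assoc, mul_smul_comm, one_mul, mul_one]
      module
    rw [h4, map_add, add_le_add_iff_right] at h3
    have h5 : 0 ≤ y * y := by
      have := star_mul_self_nonneg y
      rwa [hys] at this
    exact (le_add_of_nonneg_left h5).trans h3
  have hy0 : y = 0 := by
    have := eq_zero_of_forall_smul_le hbound
    simpa using this
  rw [hy0, smul_zero, add_zero] at hdec
  rw [← hdec]
  exact hxs

/-- After scaling, `0 ≤ a ≤ 1`. Then `‖1 - E(a)‖ ≤ ‖1 - a‖ ≤ 1`, and since `E(a)` is self-adjoint,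
`1 - E(a) ≤ 1`. -/
theorem expect_nonneg [PartialOrder A] [StarOrderedRing A] {a : A} (ha : 0 ≤ a) :
    0 ≤ P.expect a := by
  have key : ∀ a : A, 0 ≤ a → ‖a‖ ≤ 1 → 0 ≤ P.expect a := by
    intro a ha h1
    have hsa := P.isSelfAdjoint_expect (IsSelfAdjoint.of_nonneg ha)
    have h3 : ‖1 - a‖ ≤ 1 := by
      have ha1 : a ≤ 1 := (CStarAlgebra.norm_le_one_iff_of_nonneg a ha).mp h1
      exact (CStarAlgebra.norm_le_one_iff_of_nonneg (1 - a) (sub_nonneg.mpr ha1)).mpr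
        (sub_le_self 1 ha)
    have h4 : ‖1 - P.expect a‖ ≤ 1 := by
      have := P.norm_expect_le (1 - a)
      rw [map_sub, P.expect_one] at this
      exact this.trans h3
    have h5 : 1 - P.expect a ≤ 1 := by
      refine (((IsSelfAdjoint.one B).sub hsa).le_algebraMap_norm_self).trans ?_
      simpa using algebraMap_mono B h4
    exact sub_le_self_iff _ |>.mp h5
  have hpos : (0 : ℝ) < ‖a‖ + 1 := by positivity
  have h1 := key ((‖a‖ + 1)⁻¹ • a) (smul_nonneg (inv_nonneg.mpr hpos.le) ha) (by
    rw [norm_smul, norm_inv, Real.norm_of_nonneg hpos.le, inv_mul_le_iff₀ hpos]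
    linarith)
  have h2 : P.expect ((‖a‖ + 1)⁻¹ • a) = (‖a‖ + 1)⁻¹ • P.expect a := by
    rw [← Complex.coe_smul, map_smul, Complex.coe_smul]
  rw [h2] at h1
  have h3 := smul_nonneg hpos.le h1
  rwa [smul_smul, mul_inv_cancel₀ hpos.ne', one_smul] at h3

omit [PartialOrder B] [StarOrderedRing B] in
theorem mul_expect_mul (b₁ b₂ : B) (a : A) :
    b₁ * P.expect a * b₂ = P.expect (P.incl b₁ * a * P.incl b₂) :=
  (P.expect_bimodule b₁ a b₂).symm

/-- Compressions `b ↦ E(z* b z)` of a contractive conditional expectation are completely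
positive. -/
def compressionCP (z : A) : B →CP B where
  toFun b := P.expect (star z * P.incl b * z)
  map_add' b c := by simp [mul_add, add_mul]
  map_smul' c b := by simp [map_smul]
  map_cstarMatrix_nonneg' k M hM := by
    let _ := CStarAlgebra.spectralOrder A
    have _ := CStarAlgebra.spectralOrderedRing A
    obtain ⟨N, rfl⟩ := exists_eq_star_mul_self_of_nonneg hM
    refine CStarMatrix.nonneg_of_isPosKernel fun b => ?_
    -- With `M = N* N`, the expression is `E(∑ₗ yₗ* yₗ)` for `yₗ = ∑ⱼ Nₗⱼ z bⱼ`.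
    have : ∑ i, ∑ j, star (b i) * P.expect (star z * P.incl ((star N * N) i j) * z) * b j =
        P.expect (∑ l, star (∑ i, P.incl (N l i) * z * P.incl (b i)) *
          ∑ j, P.incl (N l j) * z * P.incl (b j)) := by
      simp only [mul_expect_mul]
      simp only [CStarMatrix.mul_apply, CStarMatrix.star_apply, star_sum,
        star_mul, Finset.sum_mul, Finset.mul_sum, map_sum, map_mul, map_star, mul_assoc]
      rw [Finset.sum_comm' (t' := Finset.univ) (s' := fun _ => Finset.univ) (by simp)]
      conv_rhs => rw [Finset.sum_comm]
      refine Finset.sum_congr rfl fun j _ => ?_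
      rw [Finset.sum_comm]
    change 0 ≤ ∑ i, ∑ j, star (b i) * P.expect (star z * P.incl ((star N * N) i j) * z) * b j
    rw [this]
    exact P.expect_nonneg (Finset.sum_nonneg fun l _ => star_mul_self_nonneg _)

end CStarProbSpace

/-! ### The inner product of words and its positivity. -/

theorem CompletelyPositiveMap.map_star {B : Type*} [CStarAlgebra B] [PartialOrder B]
    [StarOrderedRing B] (φ : B →CP B) (b : B) : φ (star b) = star (φ b) :=
  StarHomClass.map_star
    (PositiveLinearMap.mk₀ (φ : B →ₗ[ℂ] B) fun a ha => by
      simpa using OrderHomClass.mono φ ha) b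

/-- The words `b₀ x_{i₁} b₁ x_{i₂} ⋯ x_{iₙ} bₙ` spanning the algebraic full Fock space over `B` with
generators `x_i`. -/
inductive FockWord (B : Type u) (ι : Type v) : Type (max u v)
  | nil (b : B) : FockWord B ι
  | cons (b : B) (i : ι) (w : FockWord B ι) : FockWord B ι

namespace FockWord

section Basic

variable {B : Type u} [Ring B] {ι : Type v}

/-- The number of generators in a word. -/
def depth : FockWord B ι → ℕ
  | nil _ => 0
  | cons _ _ w => w.depth + 1

/-- Multiply the first coefficient of a word on the left. -/
def lmul (a : B) : FockWord B ι → FockWord B ι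
  | nil b => nil (a * b)
  | cons b i w => cons (a * b) i w

/-- Multiply the last coefficient of a word on the right. -/
def rmul (a : B) : FockWord B ι → FockWord B ι
  | nil b => nil (b * a)
  | cons b i w => cons b i (w.rmul a)

/-- The coefficient of a word without generators, and `0` for all other words. -/
def scalarPart : FockWord B ι → B
  | nil b => b
  | cons _ _ _ => 0

/-- The first coefficient of a word whose first generator is `x_i`, and `0` for all other words. -/
def headPart [DecidableEq ι] (i : ι) : FockWord B ι → B
  | nil _ => 0
  | cons b j _ => if j = i then b else 0

/-- Remove the first coefficient and generator of a word. -/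
def tail : FockWord B ι → FockWord B ι
  | nil b => nil b
  | cons _ _ w => w

@[simp] theorem lmul_one (w : FockWord B ι) : w.lmul 1 = w := by
  cases w <;> simp [lmul]

end Basic

section Kernel

variable {B : Type u} [CStarAlgebra B] [PartialOrder B] [StarOrderedRing B]
  {ι : Type v} [DecidableEq ι] (γ : ι → B →CP B)

/-- The `B`-valued inner product `⟨v, m w⟩` of two words of the full Fock space, where
`⟨x_i, b x_j⟩ = δᵢⱼ γᵢ(b)`. -/
noncomputable def kernel : B → FockWord B ι → FockWord B ι → B
  | m, nil b, nil c => star b * m * c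
  | m, cons b i v, cons c j w => if i = j then kernel (γ i (star b * m * c)) v w else 0
  | _, nil _, cons _ _ _ => 0
  | _, cons _ _ _, nil _ => 0

theorem kernel_add (m m' : B) (v w : FockWord B ι) :
    kernel γ (m + m') v w = kernel γ m v w + kernel γ m' v w := by
  induction v generalizing m m' w with
  | nil b => cases w <;> simp [kernel, mul_add, add_mul]
  | cons b i v ih =>
    cases w with
    | nil c => simp [kernel]
    | cons c j w =>
      by_cases h : i = j <;> simp [kernel, h, mul_add, add_mul, map_add, ih]

theorem kernel_smul (r : ℂ) (m : B) (v w : FockWord B ι) :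
    kernel γ (r • m) v w = r • kernel γ m v w := by
  induction v generalizing m w with
  | nil b => cases w <;> simp [kernel]
  | cons b i v ih =>
    cases w with
    | nil c => simp [kernel]
    | cons c j w =>
      by_cases h : i = j <;> simp [kernel, h, ih]

@[simp] theorem kernel_zero (v w : FockWord B ι) : kernel γ 0 v w = 0 := by
  simpa using kernel_smul γ 0 0 v w

theorem star_kernel (m : B) (v w : FockWord B ι) :
    star (kernel γ m v w) = kernel γ (star m) w v := by
  induction v generalizing m w with
  | nil b => cases w <;> simp [kernel, mul_assoc]
  | cons b i v ih =>
    cases w with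
    | nil c => simp [kernel]
    | cons c j w =>
      by_cases h : i = j
      · subst h
        simp [kernel, ih, ← CompletelyPositiveMap.map_star, mul_assoc]
      · simp [kernel, h, Ne.symm h]

theorem kernel_lmul_right (m a : B) (v w : FockWord B ι) :
    kernel γ m v (w.lmul a) = kernel γ (m * a) v w := by
  cases v <;> cases w <;> simp [kernel, lmul, mul_assoc]

theorem kernel_lmul_left (m a : B) (v w : FockWord B ι) :
    kernel γ m (v.lmul a) w = kernel γ (star a * m) v w := by
  cases v <;> cases w <;> simp [kernel, lmul, mul_assoc]

theorem kernel_rmul_right (m a : B) (v w : FockWord B ι) :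
    kernel γ m v (w.rmul a) = kernel γ m v w * a := by
  induction v generalizing m w with
  | nil b => cases w <;> simp [kernel, rmul, mul_assoc]
  | cons b i v ih =>
    cases w with
    | nil c => simp [kernel, rmul]
    | cons c j w =>
      by_cases h : i = j <;> simp [kernel, rmul, h, ih]

/-- This form treats words of all shapes uniformly: the values of `tail` on words without generators
do not matter, since `headPart` is zero there. -/
theorem kernel_eq_sum [Fintype ι] (m : B) (v w : FockWord B ι) :
    kernel γ m v w = star v.scalarPart * m * w.scalarPart +
      ∑ i, kernel γ (γ i (star (v.headPart i) * m * w.headPart i)) v.tail w.tail := by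
  cases v with
  | nil b => cases w <;> simp [kernel, scalarPart, headPart, tail]
  | cons b i v =>
    cases w with
    | nil c => simp [kernel, scalarPart, headPart, tail]
    | cons c j w =>
      simp only [kernel, scalarPart, headPart, tail]
      rw [Finset.sum_eq_single i (by intro k _ hk; simp [hk.symm]) (by simp)]
      by_cases h : i = j
      · simp [h]
      · simp [h, Ne.symm h]

/-- Induction on the depth: conjugation, the maps `γ i` and sums all preserve positive kernels, and
passing to tails lowers the depth. The middle entry must be a varying matrix `M i j` for the
induction to go through. -/
theorem isPosKernel_kernel [Fintype ι] {n : Type*} [Fintype n] {M : n → n → B}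
    (hM : IsPosKernel M) (w : n → FockWord B ι) :
    IsPosKernel fun i j => kernel γ (M i j) (w i) (w j) := by
  obtain ⟨N, hN⟩ : ∃ N, ∀ i, (w i).depth ≤ N :=
    ⟨Finset.univ.sup fun i => (w i).depth, fun i =>
      Finset.le_sup (f := fun i => (w i).depth) (Finset.mem_univ i)⟩
  induction N generalizing M w with
  | zero =>
    have : ∀ i, ∃ b, w i = nil b := by
      intro i
      have := hN i
      cases h : w i with
      | nil b => exact ⟨b, rfl⟩
      | cons b j v => simp [h, depth] at this
    choose b hb using this
    simpa [hb, kernel] using hM.conj b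
  | succ N ih =>
    simp only [fun i j => kernel_eq_sum γ (M i j) (w i) (w j)]
    refine (hM.conj _).add (IsPosKernel.sum fun x _ => ih ((hM.conj _).map (γ x)) _ ?_)
    intro i
    have := hN i
    cases h : w i <;> simp [h, depth, tail] at this ⊢
    exact this

end Kernel

end FockWord

/-! ### The algebraic full Fock space and its `B`-valued form. -/

/-- The algebraic full Fock space of a family of completely positive maps `γ`. -/
def FockSpace {B : Type u} [CStarAlgebra B] [PartialOrder B] [StarOrderedRing B]
    {ι : Type v} (_γ : ι → B →CP B) : Type (max u v) :=
  FockWord B ι →₀ ℂ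

namespace FockSpace

open FockWord

variable {B : Type u} [CStarAlgebra B] [PartialOrder B] [StarOrderedRing B]
  {ι : Type v} {γ : ι → B →CP B}

noncomputable instance : AddCommGroup (FockSpace γ) :=
  inferInstanceAs <| AddCommGroup (FockWord B ι →₀ ℂ)

noncomputable instance : Module ℂ (FockSpace γ) :=
  inferInstanceAs <| Module ℂ (FockWord B ι →₀ ℂ)

variable (γ) in
/-- The vector given by a word. -/
noncomputable def ofWord (w : FockWord B ι) : FockSpace γ := Finsupp.single w (1 : ℂ)

variable (γ) in
/-- A linear map is given by its values on words. -/
noncomputable def lift {V : Type*} [AddCommGroup V] [Module ℂ V] (f : FockWord B ι → V) :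
    FockSpace γ →ₗ[ℂ] V :=
  Finsupp.linearCombination ℂ f

@[simp] theorem lift_ofWord {V : Type*} [AddCommGroup V] [Module ℂ V] (f : FockWord B ι → V)
    (w : FockWord B ι) : lift γ f (ofWord γ w) = f w := by
  exact (Finsupp.linearCombination_single ℂ (1 : ℂ) w).trans (one_smul ℂ _)

theorem induction {p : FockSpace γ → Prop} (zero : p 0) (add : ∀ f g, p f → p g → p (f + g))
    (smul : ∀ (c : ℂ) f, p f → p (c • f)) (word : ∀ w, p (ofWord γ w)) (f : FockSpace γ) : p f := by
  refine Finsupp.induction_linear (motive := p) f zero add fun w c => ?_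
  have : (Finsupp.single w c : FockWord B ι →₀ ℂ) = c • Finsupp.single w (1 : ℂ) := by simp
  rw [this]
  exact smul c _ (word w)

variable [DecidableEq ι]

/-- The `B`-valued sesquilinear form `⟨f, m g⟩`. -/
noncomputable def form (m : B) (f g : FockSpace γ) : B :=
  -- The two stars make the linear extension conjugate-linear in `f`.
  lift γ (fun w => star (lift γ (fun v => star (kernel γ m v w)) f)) g

@[simp] theorem form_add_right (m : B) (f g h : FockSpace γ) :
    form m f (g + h) = form m f g + form m f h := by
  simp [form]

@[simp] theorem form_smul_right (m : B) (c : ℂ) (f g : FockSpace γ) :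
    form m f (c • g) = c • form m f g := by
  simp [form]

@[simp] theorem form_zero_right (m : B) (f : FockSpace γ) : form m f 0 = 0 := by
  simp [form]

@[simp] theorem form_ofWord (m : B) (v w : FockWord B ι) :
    form m (ofWord γ v) (ofWord γ w) = kernel γ m v w := by
  simp [form]

@[simp] theorem form_add_left (m : B) (f g h : FockSpace γ) :
    form m (f + g) h = form m f h + form m g h := by
  induction h using FockSpace.induction with
  | zero => simp
  | add h k hh hk => simp only [form_add_right, hh, hk]; abel
  | smul c h hh => simp only [form_smul_right, hh, smul_add]
  | word w => simp [form]

@[simp] theorem form_smul_left (m : B) (c : ℂ) (f g : FockSpace γ) :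
    form m (c • f) g = star c • form m f g := by
  induction g using FockSpace.induction with
  | zero => simp
  | add h k hh hk => simp only [form_add_right, hh, hk, smul_add]
  | smul d h hh =>
    simp only [form_smul_right, hh]
    exact smul_comm _ _ _
  | word w => simp [form]

@[simp] theorem form_zero_left (m : B) (f : FockSpace γ) : form m 0 f = 0 := by
  simpa using form_smul_left m 0 0 f

omit [DecidableEq ι] in
theorem form_ext {p q : FockSpace γ → FockSpace γ → B}
    (hpr : ∀ f g h, p f (g + h) = p f g + p f h) (hpl : ∀ f g h, p (f + g) h = p f h + p g h)
    (hpsr : ∀ (c : ℂ) f g, p f (c • g) = c • p f g)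
    (hpsl : ∀ (c : ℂ) f g, p (c • f) g = star c • p f g)
    (hqr : ∀ f g h, q f (g + h) = q f g + q f h) (hql : ∀ f g h, q (f + g) h = q f h + q g h)
    (hqsr : ∀ (c : ℂ) f g, q f (c • g) = c • q f g)
    (hqsl : ∀ (c : ℂ) f g, q (c • f) g = star c • q f g)
    (h : ∀ v w, p (ofWord γ v) (ofWord γ w) = q (ofWord γ v) (ofWord γ w)) (f g : FockSpace γ) :
    p f g = q f g := by
  induction f using FockSpace.induction with
  | zero => simpa using (hpsl 0 0 g).trans (by simpa using (hqsl 0 0 g).symm)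
  | add f f' hf hf' => rw [hpl, hql, hf, hf']
  | smul c f hf => rw [hpsl, hqsl, hf]
  | word v =>
    induction g using FockSpace.induction with
    | zero => simpa using (hpsr 0 _ 0).trans (by simpa using (hqsr 0 _ 0).symm)
    | add g g' hg hg' => rw [hpr, hqr, hg, hg']
    | smul c g hg => rw [hpsr, hqsr, hg]
    | word w => exact h v w

theorem form_add_middle (m m' : B) (f g : FockSpace γ) :
    form (m + m') f g = form m f g + form m' f g :=
  form_ext (p := fun f g => form (m + m') f g) (q := fun f g => form m f g + form m' f g)
    (by simp) (by simp) (by simp) (by simp) (by intros; simp; abel) (by intros; simp; abel)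
    (by simp) (by simp) (by simp [kernel_add]) f g

theorem form_smul_middle (c : ℂ) (m : B) (f g : FockSpace γ) :
    form (c • m) f g = c • form m f g :=
  form_ext (p := fun f g => form (c • m) f g) (q := fun f g => c • form m f g)
    (by simp) (by simp) (by simp) (by simp) (by simp) (by simp)
    (by intros; simp; exact smul_comm _ _ _)
    (by intros; simp; exact smul_comm _ _ _) (by simp [kernel_smul]) f g

theorem form_sub_middle (m m' : B) (f g : FockSpace γ) :
    form (m - m') f g = form m f g - form m' f g := by
  rw [sub_eq_add_neg, ← neg_one_smul ℂ m', form_add_middle, form_smul_middle, neg_one_smul,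
    sub_eq_add_neg]

theorem star_form (m : B) (f g : FockSpace γ) : star (form m f g) = form (star m) g f := by
  have := form_ext (p := fun f g => form m f g) (q := fun f g => star (form (star m) g f))
    (by simp) (by simp) (by simp) (by simp) (by simp) (by simp)
    (by simp) (by simp) (by simp [star_kernel]) f g
  simp [this]

theorem form_map_right_of_ofWord {m m' : B} {T S : FockSpace γ →ₗ[ℂ] FockSpace γ}
    (h : ∀ v w, form m (T (ofWord γ v)) (ofWord γ w) = form m' (ofWord γ v) (S (ofWord γ w)))
    (f g : FockSpace γ) : form m (T f) g = form m' f (S g) :=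
  form_ext (p := fun f g => form m (T f) g) (q := fun f g => form m' f (S g))
    (by simp) (by simp) (by simp) (by simp) (by simp) (by simp)
    (by simp) (by simp) h f g

theorem form_self_nonneg [Fintype ι] {m : B} (hm : 0 ≤ m) (f : FockSpace γ) :
    0 ≤ form m f f := by
  let s : Finset (FockWord B ι) := Finsupp.support f
  let c : FockWord B ι → ℂ := fun w => (show FockWord B ι →₀ ℂ from f) w
  have hf : f = ∑ w : s, c w • ofWord γ w := by
    have h1 : f = ∑ w ∈ s, c w • ofWord γ w := by
      conv_lhs => rw [← Finsupp.sum_single (show FockWord B ι →₀ ℂ from f)]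
      refine Finset.sum_congr rfl fun w _ => ?_
      simp only [ofWord]
      exact (Finsupp.smul_single_one w _).symm
    rw [h1]
    exact (Finset.sum_coe_sort s fun w => c w • ofWord γ w).symm
  have h1 : ∀ (t : Finset s) (a : s → FockSpace γ) (g : FockSpace γ),
      form m g (∑ w ∈ t, a w) = ∑ w ∈ t, form m g (a w) := fun t a g =>
    map_sum (⟨⟨form m g, form_zero_right m g⟩, form_add_right m g⟩ : FockSpace γ →+ B) a t
  have h2 : ∀ (t : Finset s) (a : s → FockSpace γ) (g : FockSpace γ),
      form m (∑ w ∈ t, a w) g = ∑ w ∈ t, form m (a w) g := fun t a g =>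
    map_sum (⟨⟨fun f => form m f g, form_zero_left m g⟩,
      fun f f' => form_add_left m f f' g⟩ : FockSpace γ →+ B) a t
  have h3 := isPosKernel_kernel γ (IsPosKernel.const (n := s) hm) (fun w => (w : FockWord B ι))
    (fun w => c w • (1 : B))
  rw [hf]
  simp only [h1, h2, form_smul_left, form_smul_right, form_ofWord]
  rw [Finset.sum_comm]
  simpa [smul_smul, mul_comm] using h3

end FockSpace

/-! ### Operators on the Fock space, Cauchy–Schwarz and the seminorm. -/

namespace FockSpace

open FockWord

variable {B : Type u} [CStarAlgebra B] [PartialOrder B] [StarOrderedRing B]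
  {ι : Type v} {γ : ι → B →CP B}

/-- The right action of `B` on the Fock space. -/
noncomputable def rmul (b : B) : FockSpace γ →ₗ[ℂ] FockSpace γ :=
  lift γ fun w => ofWord γ (w.rmul b)

/-- The left action of `B` on the Fock space. -/
noncomputable def lmul (b : B) : FockSpace γ →ₗ[ℂ] FockSpace γ :=
  lift γ fun w => ofWord γ (w.lmul b)

/-- The creation operator of the generator `x_i`. -/
noncomputable def create (i : ι) : FockSpace γ →ₗ[ℂ] FockSpace γ :=
  lift γ fun w => ofWord γ (FockWord.cons 1 i w)

variable [DecidableEq ι]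

/-- The annihilation operator of the generator `x_i`. -/
noncomputable def annihilate (i : ι) : FockSpace γ →ₗ[ℂ] FockSpace γ :=
  lift γ fun
    | nil _ => 0
    | cons b j w => if i = j then ofWord γ (w.lmul (γ i b)) else 0

theorem form_rmul_right (m b : B) (f g : FockSpace γ) :
    form m f (rmul b g) = form m f g * b := by
  refine form_ext (p := fun f g => form m f (rmul b g)) (q := fun f g => form m f g * b)
    (by simp) (by simp) (by simp) (by simp) (by simp [add_mul]) (by simp [add_mul])
    (by simp) (by simp) ?_ f g
  simp [rmul, kernel_rmul_right]

theorem form_rmul_left (m b : B) (f g : FockSpace γ) :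
    form m (rmul b f) g = star b * form m f g := by
  rw [← star_star m, ← star_form, form_rmul_right, star_mul, star_form]

theorem form_lmul_left (m b : B) (f g : FockSpace γ) :
    form m (lmul b f) g = form (star b * m) f g :=
  form_map_right_of_ofWord (S := LinearMap.id) (by simp [lmul, kernel_lmul_left]) f g

theorem form_lmul_right (m b : B) (f g : FockSpace γ) :
    form m f (lmul b g) = form (m * b) f g := by
  rw [← star_star m, ← star_form, form_lmul_left, star_form]
  simp

theorem form_create_left (i : ι) (f g : FockSpace γ) :
    form 1 (create i f) g = form 1 f (annihilate i g) := by
  refine form_map_right_of_ofWord (fun v w => ?_) f g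
  cases w with
  | nil b => simp [create, annihilate, kernel]
  | cons b j w =>
    by_cases h : i = j <;> simp [create, annihilate, kernel, h, kernel_lmul_right]

theorem annihilate_create (i j : ι) (b : B) (f : FockSpace γ) :
    annihilate i (lmul b (create j f)) = if i = j then lmul (γ i b) f else 0 := by
  induction f using FockSpace.induction with
  | zero => simp
  | add f g hf hg => by_cases h : i = j <;> simp_all
  | smul c f hf => by_cases h : i = j <;> simp_all
  | word w => by_cases h : i = j <;> simp [annihilate, lmul, create, FockWord.lmul, h]

variable [Fintype ι]

/-- Expand `⟨f a - t g, f a - t g⟩ ≥ 0` with `a = ⟨f, g⟩`, and use `a* ⟨f, f⟩ a ≤ ‖⟨f, f⟩‖ a* a`. -/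
theorem norm_form_sq_le (f g : FockSpace γ) :
    ‖form 1 f g‖ ^ 2 ≤ ‖form 1 f f‖ * ‖form 1 g g‖ := by
  set a := form 1 f g with ha
  set s := ‖form 1 f f‖ with hs
  set G := ‖form 1 g g‖ with hG
  have hff : 0 ≤ form 1 f f := form_self_nonneg zero_le_one f
  have hgg : 0 ≤ form 1 g g := form_self_nonneg zero_le_one g
  -- The strict inequality `s < t` makes `t` positive, so that it can be cancelled even if `s = 0`;
  -- afterwards `t` tends to `s`.
  have key : ∀ t : ℝ, s < t → ‖a‖ ^ 2 ≤ t * G := by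
    intro t ht
    have ht0 : 0 < t := (norm_nonneg _).trans_lt ht
    have h1 := form_self_nonneg zero_le_one (rmul a f + (-(t : ℂ)) • g)
    have hga : form 1 g f = star a := by rw [ha, star_form, star_one]
    have h2 : form 1 (rmul a f + (-(t : ℂ)) • g) (rmul a f + (-(t : ℂ)) • g) =
        star a * form 1 f f * a - (2 * t : ℝ) • (star a * a) + (t ^ 2 : ℝ) • form 1 g g := by
      simp only [form_add_left, form_add_right, form_smul_left, form_smul_right, form_rmul_left,
        form_rmul_right, hga, ← ha, star_neg, ← Complex.coe_smul]
      simp only [Complex.star_def, Complex.conj_ofReal]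
      push_cast
      simp only [mul_assoc, add_mul, smul_mul_assoc]
      module
    have h3 : star a * form 1 f f * a ≤ s • (star a * a) :=
      CStarAlgebra.star_left_conjugate_le_norm_smul (IsSelfAdjoint.of_nonneg hff)
    have haa : 0 ≤ star a * a := star_mul_self_nonneg a
    have h4 : t • (star a * a) ≤ (t ^ 2 : ℝ) • form 1 g g := by
      have h5 : t • (star a * a) ≤ (2 * t - s) • (star a * a) :=
        smul_le_smul_of_nonneg_right (by linarith) haa
      rw [h2] at h1
      have h6 := h1.trans (add_le_add_left (sub_le_sub_right h3 _) _)
      have h7 : (2 * t - s) • (star a * a) ≤ (t ^ 2 : ℝ) • form 1 g g := by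
        rw [← sub_nonneg]
        convert h6 using 1
        module
      exact h5.trans h7
    have h5 := CStarAlgebra.norm_le_norm_of_nonneg_of_le (smul_nonneg ht0.le haa) h4
    rw [norm_smul, norm_smul, CStarRing.norm_star_mul_self, Real.norm_of_nonneg ht0.le,
      Real.norm_of_nonneg (sq_nonneg t), ← sq, sq t, mul_assoc] at h5
    exact le_of_mul_le_mul_left h5 ht0
  refine le_of_forall_pos_le_add fun ε hε => ?_
  have hG0 : 0 ≤ G := norm_nonneg _
  refine (key (s + ε / (G + 1)) (lt_add_of_pos_right _ (by positivity))).trans ?_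
  have : ε / (G + 1) * G ≤ ε := by
    rw [div_mul_eq_mul_div, div_le_iff₀ (by positivity)]
    nlinarith
  linarith

noncomputable instance : Norm (FockSpace γ) := ⟨fun f => √‖form 1 f f‖⟩

omit [Fintype ι] in
theorem norm_sq_eq (f : FockSpace γ) : ‖f‖ ^ 2 = ‖form 1 f f‖ := Real.sq_sqrt (norm_nonneg _)

theorem norm_form_le (f g : FockSpace γ) : ‖form 1 f g‖ ≤ ‖f‖ * ‖g‖ := by
  refine abs_le_of_sq_le_sq' ?_
    (show 0 ≤ ‖f‖ * ‖g‖ from mul_nonneg (Real.sqrt_nonneg _) (Real.sqrt_nonneg _)) |>.2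
  rw [mul_pow, norm_sq_eq, norm_sq_eq]
  exact norm_form_sq_le f g

variable (γ) in
theorem seminormedSpaceCore : SeminormedSpace.Core ℂ (FockSpace γ) where
  norm_nonneg f := Real.sqrt_nonneg _
  norm_smul c f := by
    change √‖form 1 (c • f) (c • f)‖ = ‖c‖ * √‖form 1 f f‖
    rw [form_smul_left, form_smul_right, norm_smul, norm_smul, norm_star, ← mul_assoc,
      Real.sqrt_mul (by positivity), Real.sqrt_mul_self (norm_nonneg _)]
  norm_triangle f g := by
    have hf : 0 ≤ ‖f‖ := Real.sqrt_nonneg _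
    have hg : 0 ≤ ‖g‖ := Real.sqrt_nonneg _
    refine abs_le_of_sq_le_sq' ?_ (add_nonneg hf hg) |>.2
    rw [norm_sq_eq]
    have h : form 1 (f + g) (f + g) =
        form 1 f f + form 1 f g + form 1 g f + form 1 g g := by
      rw [form_add_left, form_add_right, form_add_right]
      abel
    rw [h]
    refine (norm_add_le _ _).trans ?_
    have h1 := norm_add_le (form 1 f f + form 1 f g) (form 1 g f)
    have h2 := norm_add_le (form 1 f f) (form 1 f g)
    have h3 := norm_form_le f g
    have h4 := norm_form_le g f
    have h5 := norm_sq_eq f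
    have h6 := norm_sq_eq g
    nlinarith

noncomputable instance : SeminormedAddCommGroup (FockSpace γ) :=
  .ofCore (seminormedSpaceCore γ)

noncomputable instance : NormedSpace ℂ (FockSpace γ) :=
  { norm_smul_le := fun c f => ((seminormedSpaceCore γ).norm_smul c f).le }

/-- Positivity of the form at `‖m‖ - m ≥ 0` gives `⟨f, m f⟩ ≤ ‖m‖ ⟨f, f⟩`. -/
theorem norm_le_of_form_eq {T : FockSpace γ →ₗ[ℂ] FockSpace γ} {m : B} (hm : 0 ≤ m)
    (h : ∀ f, form 1 (T f) (T f) = form m f f) (f : FockSpace γ) : ‖T f‖ ≤ √‖m‖ * ‖f‖ := by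
  refine abs_le_of_sq_le_sq' ?_ (by positivity) |>.2
  rw [mul_pow, norm_sq_eq, norm_sq_eq, Real.sq_sqrt (norm_nonneg _), h]
  have h1 : form m f f ≤ ‖m‖ • form 1 f f := by
    have h2 : 0 ≤ (‖m‖ : ℂ) • (1 : B) - m := by
      rw [sub_nonneg, Complex.coe_smul, ← Algebra.algebraMap_eq_smul_one]
      exact (IsSelfAdjoint.of_nonneg hm).le_algebraMap_norm_self
    have h3 := form_self_nonneg h2 f
    rwa [form_sub_middle, form_smul_middle, sub_nonneg, Complex.coe_smul] at h3
  refine (CStarAlgebra.norm_le_norm_of_nonneg_of_le (form_self_nonneg hm f) h1).trans ?_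
  rw [norm_smul, norm_norm]

/-- Cauchy–Schwarz: `‖S f‖² = ‖⟨T S f, f⟩‖ ≤ C ‖S f‖ ‖f‖`. -/
theorem norm_le_of_adjoint {T S : FockSpace γ → FockSpace γ}
    (hTS : ∀ f g, form 1 (T f) g = form 1 f (S g)) {C : ℝ} (hT : ∀ f, ‖T f‖ ≤ C * ‖f‖)
    (f : FockSpace γ) : ‖S f‖ ≤ C * ‖f‖ := by
  rcases (norm_nonneg (S f)).eq_or_lt with h | h
  · have hC : 0 ≤ C * ‖f‖ := (norm_nonneg _).trans (hT f)
    rwa [← h]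
  · have h1 : ‖S f‖ * ‖S f‖ ≤ C * ‖f‖ * ‖S f‖ := by
      rw [← sq, norm_sq_eq, ← hTS]
      refine (norm_form_le _ _).trans ?_
      calc ‖T (S f)‖ * ‖f‖ ≤ C * ‖S f‖ * ‖f‖ := by gcongr; exact hT _
        _ = _ := by ring
    exact le_of_mul_le_mul_right h1 h

theorem norm_lmul_le (b : B) (f : FockSpace γ) : ‖lmul b f‖ ≤ √‖star b * b‖ * ‖f‖ :=
  norm_le_of_form_eq (star_mul_self_nonneg b)
    (fun f => by rw [form_lmul_left, form_lmul_right, mul_one]) f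

theorem norm_create_le (i : ι) (f : FockSpace γ) : ‖create i f‖ ≤ √‖γ i 1‖ * ‖f‖ := by
  refine norm_le_of_form_eq (by simpa using OrderHomClass.mono (γ i) (zero_le_one (α := B)))
    (fun f => ?_) f
  have h1 : ∀ f : FockSpace γ, f = lmul 1 f := by
    intro f
    induction f using FockSpace.induction with
    | zero => simp
    | add f g hf hg => rw [map_add, ← hf, ← hg]
    | smul c f hf => rw [map_smul, ← hf]
    | word w => simp [lmul]
  rw [form_create_left, h1 (create i f), annihilate_create, if_pos rfl, form_lmul_right, one_mul]

end FockSpace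

/-! ### The C*-seminorm on the algebra of adjointable operators. -/

/-- The pairs `(T, S)` of bounded operators on the Fock space such that `S` is an adjoint of `T`. -/
def adjointPairs {B : Type u} [CStarAlgebra B] [PartialOrder B] [StarOrderedRing B]
    {ι : Type v} [DecidableEq ι] [Fintype ι] (γ : ι → B →CP B) :
    Subring ((FockSpace γ →L[ℂ] FockSpace γ) × (FockSpace γ →L[ℂ] FockSpace γ)ᵐᵒᵖ) where
  -- The form may be degenerate, so an adjoint need not be unique and is kept as data; the opposite
  -- ring accounts for the reversal of products.
  carrier := {p | ∀ f g, FockSpace.form 1 (p.1 f) g = FockSpace.form 1 f (p.2.unop g)}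
  mul_mem' {p q} hp hq f g := by
    change FockSpace.form 1 (p.1 (q.1 f)) g = FockSpace.form 1 f (q.2.unop (p.2.unop g))
    rw [hp, hq]
  one_mem' f g := rfl
  add_mem' {p q} hp hq f g := by
    change FockSpace.form 1 (p.1 f + q.1 f) g = FockSpace.form 1 f (p.2.unop g + q.2.unop g)
    rw [FockSpace.form_add_left, FockSpace.form_add_right, hp, hq]
  zero_mem' f g := by
    change FockSpace.form 1 0 g = FockSpace.form 1 f 0
    simp
  neg_mem' {p} hp f g := by
    change FockSpace.form 1 (-p.1 f) g = FockSpace.form 1 f (-p.2.unop g)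
    rw [← neg_one_smul ℂ, ← neg_one_smul ℂ (p.2.unop g), FockSpace.form_smul_left,
      FockSpace.form_smul_right, hp]
    simp

/-- The `*`-algebra of adjointable operators on the Fock space, each one with a chosen adjoint. -/
def FockAlgebra {B : Type u} [CStarAlgebra B] [PartialOrder B] [StarOrderedRing B]
    {ι : Type v} [DecidableEq ι] [Fintype ι] (γ : ι → B →CP B) : Type (max u v) :=
  adjointPairs γ

namespace FockAlgebra

open FockSpace

variable {B : Type u} [CStarAlgebra B] [PartialOrder B] [StarOrderedRing B]
  {ι : Type v} [DecidableEq ι] [Fintype ι] {γ : ι → B →CP B}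

noncomputable instance : SeminormedRing (FockAlgebra γ) :=
  inferInstanceAs <| SeminormedRing (adjointPairs γ)

/-- The operator underlying an element of the Fock algebra. -/
noncomputable def op (p : FockAlgebra γ) : FockSpace γ →L[ℂ] FockSpace γ := p.1.1

/-- The chosen adjoint of an element of the Fock algebra. -/
noncomputable def adj (p : FockAlgebra γ) : FockSpace γ →L[ℂ] FockSpace γ := p.1.2.unop

theorem form_op_left (p : FockAlgebra γ) (f g : FockSpace γ) :
    form 1 (p.op f) g = form 1 f (p.adj g) := p.2 f g

theorem form_op_right (p : FockAlgebra γ) (f g : FockSpace γ) :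
    form 1 f (p.op g) = form 1 (p.adj f) g := by
  have := congrArg star (form_op_left p g f)
  simpa [star_form] using this

@[ext] theorem ext {p q : FockAlgebra γ} (h : p.op = q.op) (h' : p.adj = q.adj) : p = q :=
  Subtype.ext (Prod.ext h (MulOpposite.unop_injective h'))

/-- Construct an element of the Fock algebra. -/
def mk (T S : FockSpace γ →L[ℂ] FockSpace γ) (h : ∀ f g, form 1 (T f) g = form 1 f (S g)) :
    FockAlgebra γ := ⟨(T, MulOpposite.op S), h⟩

@[simp] theorem op_mk (T S : FockSpace γ →L[ℂ] FockSpace γ) (h) : (mk T S h).op = T := rfl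
@[simp] theorem adj_mk (T S : FockSpace γ →L[ℂ] FockSpace γ) (h) : (mk T S h).adj = S := rfl
@[simp] theorem op_mul (p q : FockAlgebra γ) : (p * q).op = p.op * q.op := rfl
@[simp] theorem adj_mul (p q : FockAlgebra γ) : (p * q).adj = q.adj * p.adj := rfl
@[simp] theorem op_add (p q : FockAlgebra γ) : (p + q).op = p.op + q.op := rfl
@[simp] theorem adj_add (p q : FockAlgebra γ) : (p + q).adj = p.adj + q.adj := rfl
@[simp] theorem op_sub (p q : FockAlgebra γ) : (p - q).op = p.op - q.op := rfl
@[simp] theorem adj_sub (p q : FockAlgebra γ) : (p - q).adj = p.adj - q.adj := rfl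
@[simp] theorem op_one : (1 : FockAlgebra γ).op = 1 := rfl
@[simp] theorem adj_one : (1 : FockAlgebra γ).adj = 1 := rfl
@[simp] theorem op_zero : (0 : FockAlgebra γ).op = 0 := rfl
@[simp] theorem adj_zero : (0 : FockAlgebra γ).adj = 0 := rfl

theorem norm_eq_max (p : FockAlgebra γ) : ‖p‖ = max ‖p.op‖ ‖p.adj‖ := rfl

theorem norm_adj_le (p : FockAlgebra γ) : ‖p.adj‖ ≤ ‖p.op‖ :=
  p.adj.opNorm_le_bound (norm_nonneg _) (norm_le_of_adjoint p.form_op_left p.op.le_opNorm)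

theorem norm_eq (p : FockAlgebra γ) : ‖p‖ = ‖p.op‖ := by
  rw [norm_eq_max, max_eq_left p.norm_adj_le]

noncomputable instance : StarRing (FockAlgebra γ) where
  star p := mk p.adj p.op fun f g => (p.form_op_right f g).symm
  star_involutive _ := rfl
  star_mul _ _ := rfl
  star_add _ _ := rfl

@[simp] theorem op_star (p : FockAlgebra γ) : (star p).op = p.adj := rfl
@[simp] theorem adj_star (p : FockAlgebra γ) : (star p).adj = p.op := rfl

noncomputable instance : Algebra ℂ (FockAlgebra γ) where
  smul c p := mk (c • p.op) (star c • p.adj) fun f g => by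
    simp [form_op_left]
  algebraMap :=
    { toFun := fun c => mk (c • 1) (star c • 1) fun f g => by simp
      map_one' := by ext1 <;> simp
      map_mul' := fun c d => by
        ext1
        · simp [smul_smul]
          rw [mul_comm]
        · simp [smul_smul]
      map_zero' := by ext1 <;> simp
      map_add' := fun c d => by ext1 <;> simp [add_smul] }
  commutes' c p := by ext1 <;> simp
  smul_def' c p := by
    ext1
    · change c • p.op = _
      simp
    · change star c • p.adj = _
      simp

@[simp] theorem op_smul (c : ℂ) (p : FockAlgebra γ) : (c • p).op = c • p.op := rfl
@[simp] theorem adj_smul (c : ℂ) (p : FockAlgebra γ) : (c • p).adj = star c • p.adj := rfl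

noncomputable instance : NormedAlgebra ℂ (FockAlgebra γ) where
  norm_smul_le c p := by
    rw [norm_eq, norm_eq, op_smul, norm_smul]

instance : StarModule ℂ (FockAlgebra γ) where
  star_smul c p := by ext1 <;> simp

instance : NormedStarGroup (FockAlgebra γ) where
  norm_star_le p := by
    rw [norm_eq, norm_eq, op_star]
    exact p.norm_adj_le

/-- Cauchy–Schwarz applied to `‖p f‖² = ‖⟨f, p* p f⟩‖`. -/
theorem norm_mul_self_le (p : FockAlgebra γ) : ‖p‖ * ‖p‖ ≤ ‖star p * p‖ := by
  rw [norm_eq, norm_eq, op_mul, op_star]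
  have h : ‖p.op‖ ≤ √‖p.adj * p.op‖ := by
    refine p.op.opNorm_le_bound (Real.sqrt_nonneg _) fun f => ?_
    refine abs_le_of_sq_le_sq' ?_ (by positivity) |>.2
    rw [mul_pow, Real.sq_sqrt (norm_nonneg _), norm_sq_eq, form_op_left, sq ‖f‖]
    refine (norm_form_le _ _).trans ?_
    calc ‖f‖ * ‖(p.adj * p.op) f‖ ≤ ‖f‖ * (‖p.adj * p.op‖ * ‖f‖) := by
          gcongr
          exact (p.adj * p.op).le_opNorm f
      _ = _ := by ring
  calc ‖p.op‖ * ‖p.op‖ ≤ √‖p.adj * p.op‖ * √‖p.adj * p.op‖ := by gcongr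
    _ = _ := Real.mul_self_sqrt (norm_nonneg _)

end FockAlgebra

/-! ### Completion of a `*`-algebra in a C*-seminorm. -/

namespace UniformSpace.Completion

variable {R : Type*} [SeminormedRing R] [StarRing R] [NormedStarGroup R]

noncomputable instance : Star (Completion R) := ⟨Completion.map star⟩

theorem coe_star (a : R) : star (a : Completion R) = ((star a : R) : Completion R) :=
  Completion.map_coe star_isometry.uniformContinuous a

omit [NormedStarGroup R] in
theorem continuous_star : Continuous (star : Completion R → Completion R) :=
  Completion.continuous_map

noncomputable instance : StarRing (Completion R) where
  star_involutive a := by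
    induction a using Completion.induction_on with
    | hp => exact isClosed_eq (continuous_star.comp continuous_star) continuous_id
    | ih a => rw [coe_star, coe_star, star_star]
  star_mul a b := by
    induction a, b using Completion.induction_on₂ with
    | hp =>
      exact isClosed_eq (continuous_star.comp continuous_mul)
        ((continuous_star.comp continuous_snd).mul (continuous_star.comp continuous_fst))
    | ih a b => rw [← coe_mul, coe_star, coe_star, coe_star, star_mul, coe_mul]
  star_add a b := by
    induction a, b using Completion.induction_on₂ with
    | hp =>
      exact isClosed_eq (continuous_star.comp continuous_add)
        ((continuous_star.comp continuous_fst).add (continuous_star.comp continuous_snd))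
    | ih a b => rw [← coe_add, coe_star, coe_star, coe_star, star_add, coe_add]

/-- The completion of a `*`-algebra with respect to a C*-seminorm is a C*-algebra. -/
noncomputable abbrev cstarAlgebra [NormedAlgebra ℂ R] [StarModule ℂ R]
    (h : ∀ a : R, ‖a‖ * ‖a‖ ≤ ‖star a * a‖) : CStarAlgebra (Completion R) where
  norm_smul_le c a := by
    induction a using Completion.induction_on with
    | hp =>
      exact isClosed_le (continuous_norm.comp (continuous_const_smul c))
        (continuous_const.mul continuous_norm)
    | ih a => rw [← coe_smul, norm_coe, norm_coe]; exact norm_smul_le c a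
  norm_mul_self_le a := by
    induction a using Completion.induction_on with
    | hp =>
      exact isClosed_le (continuous_norm.mul continuous_norm)
        (continuous_norm.comp (continuous_star.mul continuous_id))
    | ih a => rw [coe_star, ← coe_mul, norm_coe, norm_coe]; exact h a
  star_smul c a := by
    induction a using Completion.induction_on with
    | hp =>
      exact isClosed_eq (continuous_star.comp (continuous_const_smul c))
        (continuous_star.const_smul (star c))
    | ih a => rw [← coe_smul, coe_star, coe_star, star_smul, coe_smul]

end UniformSpace.Completion

open UniformSpace

/-! ### The probability space of the full Fock space. -/

namespace FockAlgebra

open FockSpace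

variable {B : Type u} [CStarAlgebra B] [PartialOrder B] [StarOrderedRing B]
  {ι : Type v} [DecidableEq ι] [Fintype ι] {γ : ι → B →CP B}

noncomputable instance : CStarAlgebra (Completion (FockAlgebra γ)) :=
  Completion.cstarAlgebra norm_mul_self_le

variable (γ) in
/-- The left multiplication by an element of `B`. -/
noncomputable def lmul (b : B) : FockAlgebra γ :=
  mk ((FockSpace.lmul b).mkContinuous √‖star b * b‖ (norm_lmul_le b))
    ((FockSpace.lmul (star b)).mkContinuous √‖star (star b) * star b‖ (norm_lmul_le (star b)))
    fun f g => by
      change form 1 (FockSpace.lmul b f) g = form 1 f (FockSpace.lmul (star b) g)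
      rw [form_lmul_left, form_lmul_right, mul_one, one_mul]

variable (γ) in
/-- The creation operator of the generator `x_i`. -/
noncomputable def create (i : ι) : FockAlgebra γ :=
  mk ((FockSpace.create i).mkContinuous _ (norm_create_le i))
    ((annihilate i).mkContinuous _ (norm_le_of_adjoint (form_create_left i) (norm_create_le i)))
    fun f g => form_create_left i f g

@[simp] theorem op_lmul (b : B) (f : FockSpace γ) : (lmul γ b).op f = FockSpace.lmul b f := rfl
@[simp] theorem op_create (i : ι) (f : FockSpace γ) :
    (create γ i).op f = FockSpace.create i f := rfl
@[simp] theorem adj_create (i : ι) (f : FockSpace γ) :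
    (create γ i).adj f = annihilate i f := rfl

theorem star_lmul (b : B) : star (lmul γ b) = lmul γ (star b) := by
  ext f
  · rfl
  · change FockSpace.lmul b f = FockSpace.lmul (star (star b)) f
    rw [star_star]

/-- The difference maps into the null vectors, so it has seminorm zero and vanishes in the
completion. Operator identities thus need only be checked inside the form. -/
theorem coe_eq_coe {p q : FockAlgebra γ} (h : ∀ f g, form 1 f (p.op g) = form 1 f (q.op g)) :
    (p : Completion (FockAlgebra γ)) = q := by
  rw [← sub_eq_zero, ← Completion.coe_sub, ← norm_eq_zero, Completion.norm_coe, norm_eq]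
  refine le_antisymm ((p - q).op.opNorm_le_bound le_rfl fun f => ?_) (norm_nonneg _)
  rw [zero_mul]
  have h1 : ‖(p - q).op f‖ ^ 2 = 0 := by
    rw [norm_sq_eq]
    have h2 : ∀ g, form 1 g ((p - q).op f) = 0 := by
      intro g
      have : (p - q).op f = p.op f + (-1 : ℂ) • q.op f := by
        rw [op_sub, neg_one_smul, ← sub_eq_add_neg]
        rfl
      rw [this, form_add_right, form_smul_right, h]
      simp
    rw [h2, norm_zero]
  exact (pow_eq_zero_iff two_ne_zero).mp h1 |>.le

variable (γ) in
/-- The inclusion of `B` into the Fock algebra. -/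
noncomputable def incl : B →⋆ₐ[ℂ] Completion (FockAlgebra γ) where
  toFun b := (lmul γ b : FockAlgebra γ)
  map_one' := by
    rw [← Completion.coe_one]
    exact coe_eq_coe fun f g => by simp [form_lmul_right]
  map_mul' b c := by
    rw [← Completion.coe_mul]
    exact coe_eq_coe fun f g => by simp [form_lmul_right]
  map_zero' := by
    rw [← Completion.coe_zero]
    refine coe_eq_coe fun f g => ?_
    have := form_smul_middle (γ := γ) 0 (0 : B) f g
    simpa [form_lmul_right] using this
  map_add' b c := by
    rw [← Completion.coe_add]
    exact coe_eq_coe fun f g => by simp [form_lmul_right, form_add_middle]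
  commutes' c := by
    rw [Algebra.algebraMap_eq_smul_one, Algebra.algebraMap_eq_smul_one, ← Completion.coe_one,
      ← Completion.coe_smul]
    exact coe_eq_coe fun f g => by simp [form_lmul_right, form_smul_middle]
  map_star' b := by
    rw [Completion.coe_star, star_lmul]

variable (γ) in
/-- The vacuum vector. -/
noncomputable def vacuum : FockSpace γ := ofWord γ (FockWord.nil 1)

omit [Fintype ι] in
theorem form_vacuum : form 1 (vacuum γ) (vacuum γ) = 1 := by
  simp [vacuum, FockWord.kernel]

omit [Fintype ι] in
-- Left and right multiplication by `b` agree on the vacuum, whence the right `B`-linearity of the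
-- expectation.
theorem form_lmul_vacuum (b : B) (f : FockSpace γ) :
    form 1 f (FockSpace.lmul b (vacuum γ)) = form 1 f (vacuum γ) * b := by
  rw [← form_rmul_right]
  congr 1
  simp [FockSpace.lmul, FockSpace.rmul, vacuum, FockWord.lmul, FockWord.rmul]

theorem norm_vacuum_le : ‖vacuum γ‖ ≤ 1 := by
  refine (sq_le_one_iff₀ (norm_nonneg _)).mp ?_
  rw [norm_sq_eq, form_vacuum]
  exact CStarAlgebra.norm_one_le_one B

variable (γ) in
/-- The vacuum expectation on adjointable operators. -/
noncomputable def vacuumExpect : FockAlgebra γ →L[ℂ] B :=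
  LinearMap.mkContinuous
    { toFun := fun p => form 1 (vacuum γ) (p.op (vacuum γ))
      map_add' := fun p q => by simp
      map_smul' := fun c p => by simp } 1 fun p => by
    refine (norm_form_le _ _).trans ?_
    have h1 : ‖p.op (vacuum γ)‖ ≤ ‖p‖ := by
      rw [norm_eq]
      exact (p.op.le_opNorm _).trans (mul_le_of_le_one_right (norm_nonneg _) norm_vacuum_le)
    rw [one_mul]
    exact (mul_le_of_le_one_left (norm_nonneg _) norm_vacuum_le).trans h1

theorem vacuumExpect_apply (p : FockAlgebra γ) :
    vacuumExpect γ p = form 1 (vacuum γ) (p.op (vacuum γ)) := rfl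

variable (γ) in
/-- The vacuum expectation on the C*-algebra of the Fock space. -/
noncomputable def expect : Completion (FockAlgebra γ) →L[ℂ] B :=
  (vacuumExpect γ).extend Completion.toComplL

@[simp] theorem expect_coe (p : FockAlgebra γ) :
    expect γ p = form 1 (vacuum γ) (p.op (vacuum γ)) := by
  have := ContinuousLinearMap.extend_eq (vacuumExpect γ) (e := Completion.toComplL (𝕜 := ℂ))
    Completion.denseRange_coe (Completion.isUniformInducing_coe _) p
  exact this

variable (γ) in
/-- The `B`-valued C*-noncommutative probability space of the full Fock space. -/
noncomputable def probSpace : CStarProbSpace B (Completion (FockAlgebra γ)) where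
  incl := incl γ
  incl_injective := Function.LeftInverse.injective (g := expect γ) fun b => by
    change expect γ ((lmul γ b : FockAlgebra γ) : Completion (FockAlgebra γ)) = b
    simp [form_lmul_vacuum, form_vacuum]
  expect := expect γ
  expect_incl b := by
    change expect γ ((lmul γ b : FockAlgebra γ) : Completion (FockAlgebra γ)) = b
    simp [form_lmul_vacuum, form_vacuum]
  expect_bimodule b₁ a b₂ := by
    change expect γ ((lmul γ b₁ : FockAlgebra γ) * a * (lmul γ b₂ : FockAlgebra γ)) =
      b₁ * expect γ a * b₂
    induction a using Completion.induction_on with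
    | hp =>
      exact isClosed_eq
        ((expect γ).continuous.comp ((continuous_const.mul continuous_id).mul continuous_const))
        ((continuous_const.mul (expect γ).continuous).mul continuous_const)
    | ih p =>
      rw [← Completion.coe_mul, ← Completion.coe_mul, expect_coe, expect_coe]
      have h1 : ∀ f : FockSpace γ, form 1 (vacuum γ) (FockSpace.lmul b₁ f) =
          b₁ * form 1 (vacuum γ) f := by
        intro f
        have := congrArg star (form_lmul_vacuum (star b₁) f)
        simpa [star_form, form_lmul_left, form_lmul_right] using this
      simp [h1, form_op_right, form_lmul_vacuum, mul_assoc]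
  norm_expect_le a := by
    change ‖expect γ a‖ ≤ ‖a‖
    induction a using Completion.induction_on with
    | hp => exact isClosed_le (continuous_norm.comp (expect γ).continuous) continuous_norm
    | ih p =>
      rw [expect_coe, Completion.norm_coe, ← vacuumExpect_apply]
      exact ((vacuumExpect γ).le_of_opNorm_le (LinearMap.mkContinuous_norm_le _ zero_le_one _)
        p).trans (one_mul _).le

variable (γ) in
theorem isFreeCreation : (probSpace γ).toStarProbSpace.IsFreeCreation (fun i => γ i)
    (fun i => (create γ i : Completion (FockAlgebra γ))) where
  star_mul_mul i j b := by
    change star ((create γ i : FockAlgebra γ) : Completion (FockAlgebra γ)) *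
      (lmul γ b : FockAlgebra γ) * (create γ j : FockAlgebra γ) =
      if i = j then ((lmul γ (γ i b) : FockAlgebra γ) : Completion (FockAlgebra γ)) else 0
    rw [Completion.coe_star, ← Completion.coe_mul, ← Completion.coe_mul]
    split_ifs with hij
    · refine coe_eq_coe fun f g => ?_
      change form 1 f (annihilate i (FockSpace.lmul b (FockSpace.create j g))) = _
      rw [annihilate_create, if_pos hij, op_lmul]
    · rw [← Completion.coe_zero]
      refine coe_eq_coe fun f g => ?_
      change form 1 f (annihilate i (FockSpace.lmul b (FockSpace.create j g))) = form 1 f 0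
      rw [annihilate_create, if_neg hij]
  expect_mul i a := by
    change expect γ ((create γ i : FockAlgebra γ) * a) = 0
    induction a using Completion.induction_on with
    | hp =>
      exact isClosed_eq ((expect γ).continuous.comp (continuous_const.mul continuous_id))
        continuous_const
    | ih p =>
      rw [← Completion.coe_mul, expect_coe, op_mul, mul_apply_eq_comp, form_op_right,
        adj_create]
      simp [vacuum, annihilate]
  expect_mul_star i a := by
    change expect γ (a * star ((create γ i : FockAlgebra γ) : Completion (FockAlgebra γ))) = 0
    rw [Completion.coe_star]
    induction a using Completion.induction_on with
    | hp =>
      exact isClosed_eq ((expect γ).continuous.comp (continuous_id.mul continuous_const))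
        continuous_const
    | ih p =>
      rw [← Completion.coe_mul, expect_coe, op_mul, mul_apply_eq_comp, op_star,
        adj_create]
      simp [vacuum, annihilate]

end FockAlgebra

/-! ### The characterization of covariances. -/

theorem mainTheorem8 (B : Type u) [CStarAlgebra B] [PartialOrder B] [StarOrderedRing B]
    (α β : B →ₗ[ℂ] B) :
    (∃ (A : Type (max u v)) (_ : CStarAlgebra A) (P : CStarProbSpace B A) (z : A),
      P.toStarProbSpace.IsCircular α β z) ↔
    (∃ φ : B →CP B, φ.toLinearMap = α) ∧ (∃ ψ : B →CP B, ψ.toLinearMap = β) := by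
  constructor
  · rintro ⟨A, _, P, z, hz⟩
    refine ⟨⟨P.compressionCP z, LinearMap.ext hz.expect_star_mul⟩,
      ⟨P.compressionCP (star z), LinearMap.ext fun b => ?_⟩⟩
    rw [← hz.expect_mul_star b]
    nth_rewrite 2 [← star_star z]
    rfl
  · rintro ⟨⟨φ, rfl⟩, ⟨ψ, rfl⟩⟩
    -- Lifting the two-element index set to universe `v` places the Fock algebra in `Type (max u
    -- v)`.
    let γ : ULift.{v} Bool → B →CP B := fun i => if i.down then φ else ψ
    have hne : (ULift.up true : ULift.{v} Bool) ≠ ULift.up false := by simp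
    exact ⟨UniformSpace.Completion (FockAlgebra γ), inferInstance, FockAlgebra.probSpace γ, _,
      (FockAlgebra.isFreeCreation γ).isCircular hne (fun _ => rfl) (fun _ => rfl)⟩
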